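/- Let $0<a\le e^{-1}$, let $u_0\in H^1(\mathbb R)$, let $\Phi\in L^\infty_{\mathrm{loc}}([0,\infty))$ be real-valued, and let $u\in C([0,\infty),H^1(\mathbb R))$ be the mild solution of $$\partial_t u=\partial_x^2u+\bigl(\Phi(t)-a[u(t,-1)+u(t,1)]\bigr)\delta_0,\qquad u(0,\cdot)=u_0,$$ that is, for all $t>0$ and $x\in\mathbb R$, $$u(t,x)=\int_{\mathbb R}K(t,x-y)u_0(y)\,dy+\int_0^tK(t-\tau,x)\bigl(\Phi(\tau)-a[u(\tau,-1)+u(\tau,1)]\bigr)d\tau,\qquad K(t,x)=\frac{e^{-x^2/(4t)}}{\sqrt{4\pi t}},$$ where $u(t,\cdot)$ denotes the continuous representative. Put $u_+(t)=u(t,1)+u(t,-1)$, and let $p_a(\cdot,1)\in L^1_{\mathrm{loc}}([0,\infty))$ be the inverse Laplace transform of $$P_a(s,1)=\frac{Q(s,1)}{1+2a\,Q(s,1)},\qquad Q(s,\beta)=\frac{e^{-\beta\sqrt s}}{2\sqrt s}.$$ This inverse transform exists. Assume that $\Phi(t)\to\Phi_\infty$ as $t\to+\infty$ for some $\Phi_\infty\in[0,\infty)$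 (after modification of $\Phi$ on a null set). Then $p_a(\cdot,1)\in L^1([0,\infty))$ and $$\lim_{t\to+\infty}u_+(t)=2\Phi_\infty\int_0^{+\infty}p_a(t,1)\,dt.$$ If in addition $\Phi-\Phi_\infty\in L^1([0,\infty))$, then $u_+$ is absolutely continuous on every interval $[0,T]$ and $u_+'\in L^1([0,\infty))$. -/

import Mathlib

open MeasureTheory Set Filter Topology
open scoped ENNReal

noncomputable section

namespace PointSource

/-- `g` is the weak derivative of `f` on the real line, and both functions are square integrable;
thus `f` represents an element of the Sobolev space `H¹(ℝ)` whose derivative is `g`. -/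
structure HasH1Deriv (f g : ℝ → ℝ) : Prop where
  memLp : MemLp f 2 volume
  memLp_deriv : MemLp g 2 volume
  weak_deriv : ∀ φ : ℝ → ℝ, ContDiff ℝ ((⊤ : ℕ∞) : WithTop ℕ∞) φ → HasCompactSupport φ →
    ∫ x, f x * deriv φ x = -∫ x, g x * φ x

/-- Membership in the Sobolev space `H¹(ℝ)`. -/
def MemH1 (f : ℝ → ℝ) : Prop := ∃ g, HasH1Deriv f g

/-- `f ∈ L^p_loc([0, ∞))`: the function `f` is in `L^p` of every compact interval `[0, T]`. -/
def MemLpLocHalfLine (f : ℝ → ℝ) (p : ℝ≥0∞) : Prop :=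
  ∀ T : ℝ, MemLp f p (volume.restrict (Icc 0 T))

/-- The heat kernel `exp (-x² / (4 t)) / √(4 π t)`, used for `t > 0`. -/
def heatKernel (t x : ℝ) : ℝ := Real.exp (-(x ^ 2 / (4 * t))) / Real.sqrt (4 * Real.pi * t)

/-- The diffusion semigroup `exp (t Δ)` on the real line: convolution with the heat kernel. -/
def heatSemigroup (t : ℝ) (f : ℝ → ℝ) (x : ℝ) : ℝ := ∫ y, heatKernel t (x - y) * f y

/-- The intensity `Φ(t) - a (u(t,-1) + u(t,1))` of the point source at the origin. -/
def intensity (a : ℝ) (Φ : ℝ → ℝ) (u : ℝ → ℝ → ℝ) (t : ℝ) : ℝ :=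
  Φ t - a * (u t (-1) + u t 1)

/-- `u` (written `u t x`, relevant for `t ≥ 0`) is the mild solution in `C([0, ∞), H¹(ℝ))` of
`∂ₜ u = ∂ₓ² u + (Φ(t) - a (u(t,-1) + u(t,1))) δ₀`, `u(0, ·) = u₀`.
Each `u t` is the continuous representative of its class in `H¹(ℝ)`, so that the point values are
those of the Sobolev embedding. The last field is the variation of constants formula
`u(t) = exp (t Δ) u₀ + ∫₀ᵗ exp ((t - τ) Δ) (Ψ(τ) δ₀) dτ`, in which `exp (s Δ) δ₀` is the heat
kernel at time `s`. -/
structure IsMildSolution (a : ℝ) (Φ u₀ : ℝ → ℝ) (u : ℝ → ℝ → ℝ) : Prop where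
  continuous_space : ∀ t, 0 ≤ t → Continuous (u t)
  continuous_time : ∃ ux : ℝ → ℝ → ℝ, (∀ t, 0 ≤ t → HasH1Deriv (u t) (ux t)) ∧
    ∀ t₀, 0 ≤ t₀ → Tendsto (fun t => eLpNorm (u t - u t₀) 2 volume +
      eLpNorm (ux t - ux t₀) 2 volume) (𝓝[Ici 0] t₀) (𝓝 0)
  initial : u 0 =ᵐ[volume] u₀
  variation_of_constants : ∀ t, 0 < t → ∀ x,
    u t x = heatSemigroup t u₀ x + ∫ τ in (0 : ℝ)..t, heatKernel (t - τ) x * intensity a Φ u τ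

/-- `u₊(t) = u(t,1) + u(t,-1)`. -/
def uPlus (u : ℝ → ℝ → ℝ) (t : ℝ) : ℝ := u t 1 + u t (-1)

/-- `f` is an inverse Laplace transform of `F`: `f ∈ L¹_loc([0, ∞))`, and on some right half-plane
the (improper) Laplace integral of `f` converges to `F`. -/
def IsInverseLaplace (f : ℝ → ℝ) (F : ℂ → ℂ) : Prop :=
  MemLpLocHalfLine f 1 ∧ ∃ σ : ℝ, ∀ s : ℂ, σ < s.re →
    Tendsto (fun T : ℝ => ∫ t in (0 : ℝ)..T, Complex.exp (-s * t) * (f t : ℂ)) atTop (𝓝 (F s))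

/-- `Q(s, β) = exp (-β √s) / (2 √s)`, with the principal branch of the square root. -/
def Q (s : ℂ) (β : ℝ) : ℂ :=
  Complex.exp (-β * s ^ (1 / 2 : ℂ)) / (2 * s ^ (1 / 2 : ℂ))

/-- The transfer function `P_a(s, β) = Q(s, β) / (1 + 2 a Q(s, 1))`. -/
def P (a : ℝ) (s : ℂ) (β : ℝ) : ℂ := Q s β / (1 + 2 * a * Q s 1)

/-- `f' ∈ L¹([0, ∞))`: the function `f` is absolutely continuous on every interval `[0, T]`, and its
derivative (which then exists almost everywhere and is the weak derivative) is integrable. -/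
def HasL1Deriv (f : ℝ → ℝ) : Prop :=
  (∀ T : ℝ, 0 < T → AbsolutelyContinuousOnInterval f 0 T) ∧ IntegrableOn (deriv f) (Ioi 0) volume

end PointSource

end

noncomputable section

namespace PointSource

/-! ### The heat kernel -/

/-! Write `k(t) = K(t,1)` and let `h(t)` be the sum of the values at `1` and `-1` of the free
evolution of the initial datum. Since `K` is even in space, adding the mild formula at the two
points gives a closed scalar Volterra equation `u₊ = h + 2 k * (Φ - a u₊)`
(`IsMildSolution.uPlus_eq`). If `p` solves the resolvent equation `p + 2a k * p = k`, then `u₊ = h -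
2a p * h + 2 p * Φ` (`volterra_solution`).

The crux is that `p` is integrable. With `w = √s` the transfer function is `exp(-w) / (2 (w + a
exp(-w)))`, and `1 / (w + a exp(-w))` is the Laplace transform in `w` of the fundamental solution
`Y` of the delay equation `Y' = -a Y(· - 1)`. For `a ≤ 1/e` this solution does not oscillate
(`monotoneOn_exp_mul_delaySol`), so `Y ≥ 0` and `a ∫ Y ≤ 1`. Passing from `w` back to `√s` is
subordination: `exp(-y√s)` is the Laplace transform of the first passage density at distance `y`, a
probability density. Hence `p(t) = ½ ∫ Y(x) passageDensity (x+1) t dx` is nonnegative and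
integrable. Analytic continuation from the positive reals (`transferLaplace_eq_P`) and uniqueness of
the Laplace transform (`ae_eq_zero_of_laplace_eq_zero`) identify it with every inverse transform of
`P_a(·,1)` and give the resolvent equation.

The limit follows because `h → 0`, and convolution of an integrable function with a bounded
convergent one converges (`tendsto_conv_atTop`). For the derivative, `h` is a constant plus a
primitive of an integrable function, by heat estimates that use one derivative of the initial datum
near `t = 0`. Likewise `p` is the primitive of `m = k' - 2a k' * p`, which is integrable because
`k'` is. Writing `Φ = Φ_∞ + Ψ` with `Ψ` integrable, all terms become primitives of integrable
functions. -/

theorem heatKernel_of_nonpos {t : ℝ} (ht : t ≤ 0) (x : ℝ) : heatKernel t x = 0 := by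
  -- The square root of a nonpositive number and division by zero both take the value `0`, so the
  -- kernel is extended by zero to nonpositive times.
  have h : Real.sqrt (4 * Real.pi * t) = 0 :=
    Real.sqrt_eq_zero_of_nonpos (mul_nonpos_of_nonneg_of_nonpos (by positivity) ht)
  simp [heatKernel, h]

theorem heatKernel_nonneg (t x : ℝ) : 0 ≤ heatKernel t x := by
  unfold heatKernel; positivity

theorem heatKernel_neg (t x : ℝ) : heatKernel t (-x) = heatKernel t x := by
  simp [heatKernel]

@[fun_prop]
theorem measurable_heatKernel_uncurry : Measurable fun q : ℝ × ℝ => heatKernel q.1 q.2 := by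
  unfold heatKernel; fun_prop

theorem hasDerivAt_heatKernel_time {t : ℝ} (ht : 0 < t) (x : ℝ) :
    HasDerivAt (fun s => heatKernel s x)
      (heatKernel t x * (x ^ 2 / (4 * t ^ 2) - 1 / (2 * t))) t := by
  have hs : 0 < 4 * Real.pi * t := by positivity
  have hsq : Real.sqrt (4 * Real.pi * t) ^ 2 = 4 * Real.pi * t := Real.sq_sqrt hs.le
  have hsp : 0 < Real.sqrt (4 * Real.pi * t) := Real.sqrt_pos.2 hs
  have h1 : HasDerivAt (fun s : ℝ => -(x ^ 2 / (4 * s))) (x ^ 2 / (4 * t ^ 2)) t := by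
    have h := (((hasDerivAt_id t).const_mul 4).inv (by simp [ht.ne'])).const_mul (-x ^ 2)
    convert! h using 1
    · ext s; simp; ring
    · simp; field_simp
  have h2 : HasDerivAt (fun s : ℝ => Real.sqrt (4 * Real.pi * s))
      (4 * Real.pi / (2 * Real.sqrt (4 * Real.pi * t))) t := by
    have h := ((hasDerivAt_id t).const_mul (4 * Real.pi)).sqrt (by simpa using hs.ne')
    simpa using h
  have h := h1.exp.div h2 hsp.ne'
  convert! h using 1
  unfold heatKernel
  generalize Real.exp (-(x ^ 2 / (4 * t))) = E at *
  -- Eliminating `π` in favour of the square root leaves a rational identity.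
  have e2 : Real.pi = Real.sqrt (4 * Real.pi * t) ^ 2 / (4 * t) := by rw [hsq]; field_simp
  generalize hS : Real.sqrt (4 * Real.pi * t) = S at *
  rw [e2]
  field_simp

theorem hasDerivAt_heatKernel_space {t : ℝ} (ht : 0 < t) (x : ℝ) :
    HasDerivAt (fun y => heatKernel t y) (heatKernel t x * (-(x / (2 * t)))) x := by
  have h1 : HasDerivAt (fun y : ℝ => -(y ^ 2 / (4 * t))) (-(x / (2 * t))) x := by
    have h := ((hasDerivAt_pow 2 x).div_const (4 * t)).neg
    convert! h using 1
    simp; field_simp; norm_num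
  have h := h1.exp.div_const (Real.sqrt (4 * Real.pi * t))
  convert! h using 1
  unfold heatKernel; ring

/-- The value agrees with the one in `hasDerivAt_heatKernel_time`: this is the heat equation. It
later allows one derivative to be moved onto the initial datum. -/
theorem hasDerivAt_heatKernel_space_deriv {t : ℝ} (ht : 0 < t) (x : ℝ) :
    HasDerivAt (fun y => heatKernel t y * (-(y / (2 * t))))
      (heatKernel t x * (x ^ 2 / (4 * t ^ 2) - 1 / (2 * t))) x := by
  have h := (hasDerivAt_heatKernel_space ht x).mul ((hasDerivAt_id x).div_const (2 * t)).neg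
  convert! h using 1
  simp; field_simp; ring

theorem continuous_heatKernel_space (t : ℝ) : Continuous (heatKernel t) := by
  unfold heatKernel; fun_prop

/-! ### The kernel at distance one -/

/-- From `1 + r ≤ exp r` with `r = 1/(4t)` one gets `exp(-1/(4t)) ≤ 4t`, which beats the singular
prefactor. The distance from the source thus makes the kernel continuous at time zero. -/
theorem heatKernel_one_le_two_mul_sqrt {t : ℝ} (ht : 0 < t) :
    heatKernel t 1 ≤ 2 * Real.sqrt t := by
  unfold heatKernel
  have h1 : Real.exp (-(1 ^ 2 / (4 * t))) ≤ 4 * t := by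
    rw [Real.exp_neg, inv_le_comm₀ (Real.exp_pos _) (by positivity)]
    have := Real.add_one_le_exp (1 ^ 2 / (4 * t))
    refine le_trans ?_ this
    rw [one_pow, one_div]; linarith
  have h2 : 2 * Real.sqrt t ≤ Real.sqrt (4 * Real.pi * t) := by
    apply Real.le_sqrt_of_sq_le
    rw [mul_pow, Real.sq_sqrt ht.le]
    nlinarith [Real.pi_gt_three]
  have h3 := Real.sqrt_pos.2 ht
  rw [div_le_iff₀ (by linarith)]
  nlinarith [Real.mul_self_sqrt ht.le]

theorem heatKernel_le_inv_sqrt (t x : ℝ) : heatKernel t x ≤ 1 / Real.sqrt t := by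
  rcases le_or_gt t 0 with ht | ht
  · rw [heatKernel_of_nonpos ht]; positivity
  unfold heatKernel
  have h2 : Real.sqrt t ≤ Real.sqrt (4 * Real.pi * t) := by
    apply Real.sqrt_le_sqrt
    nlinarith [Real.pi_gt_three]
  have h3 := Real.sqrt_pos.2 ht
  have h1 : Real.exp (-(x ^ 2 / (4 * t))) ≤ 1 := Real.exp_le_one_iff.2 (by
    rw [Left.neg_nonpos_iff]; positivity)
  gcongr

theorem heatKernel_one_le (t : ℝ) : heatKernel t 1 ≤ 2 := by
  rcases le_or_gt t 0 with ht | ht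
  · rw [heatKernel_of_nonpos ht]; norm_num
  rcases le_or_gt t 1 with h | h
  · refine (heatKernel_one_le_two_mul_sqrt ht).trans ?_
    have := Real.sqrt_le_one.2 h
    linarith
  · refine (heatKernel_le_inv_sqrt t 1).trans ?_
    have : 1 ≤ Real.sqrt t := Real.one_le_sqrt.2 h.le
    rw [div_le_iff₀ (by linarith)]; linarith

theorem tendsto_heatKernel_atTop (x : ℝ) : Tendsto (fun t => heatKernel t x) atTop (𝓝 0) := by
  refine squeeze_zero (fun t => heatKernel_nonneg t x) (fun t => heatKernel_le_inv_sqrt t x) ?_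
  simpa [Function.comp_def] using (tendsto_inv_atTop_zero.comp Real.tendsto_sqrt_atTop)

theorem continuousAt_heatKernel_one_zero :
    ContinuousAt (fun t => heatKernel t 1) 0 := by
  unfold ContinuousAt
  rw [show (fun t => heatKernel t 1) 0 = 0 from heatKernel_of_nonpos le_rfl 1]
  refine squeeze_zero (g := fun t => 2 * Real.sqrt t) (fun t => heatKernel_nonneg t 1)
    (fun t => ?_) ?_
  · rcases le_or_gt t 0 with ht | ht
    · rw [heatKernel_of_nonpos ht]; positivity
    · exact heatKernel_one_le_two_mul_sqrt ht
  · have : ContinuousAt (fun t => 2 * Real.sqrt t) 0 := by fun_prop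
    simpa [ContinuousAt] using this

/-- The time derivative of the heat kernel at distance one. -/
def kernelDeriv (t : ℝ) : ℝ := heatKernel t 1 * (1 / (4 * t ^ 2) - 1 / (2 * t))

theorem hasDerivAt_heatKernel_one {t : ℝ} (ht : 0 < t) :
    HasDerivAt (fun s => heatKernel s 1) (kernelDeriv t) t := by
  simpa [kernelDeriv] using hasDerivAt_heatKernel_time ht 1

/-- The kernel increases on `(0, 1/2]` and decreases afterwards, with limit `0` at both ends; a
derivative of constant sign is integrable as soon as its primitive has limits. -/
theorem integrableOn_kernelDeriv : IntegrableOn kernelDeriv (Ioi 0) := by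
  rw [← Ioc_union_Ioi_eq_Ioi (show (0 : ℝ) ≤ 1 / 2 by norm_num)]
  refine IntegrableOn.union ?_ ?_
  · refine intervalIntegral.integrableOn_deriv_of_nonneg (g := fun s => heatKernel s 1)
      (fun t ht => ?_) (fun t ht => hasDerivAt_heatKernel_one ht.1) (fun t ht => ?_)
    · rcases ht.1.eq_or_lt with h | h
      · rw [← h]; exact continuousAt_heatKernel_one_zero.continuousWithinAt
      · exact (hasDerivAt_heatKernel_one h).continuousAt.continuousWithinAt
    · refine mul_nonneg (heatKernel_nonneg _ _) ?_
      have ht0 := ht.1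
      have ht1 := ht.2
      rw [sub_nonneg]
      apply one_div_le_one_div_of_le (by positivity)
      nlinarith
  · refine integrableOn_Ioi_deriv_of_nonpos' (g := fun s => heatKernel s 1)
      (fun t ht => hasDerivAt_heatKernel_one (lt_of_lt_of_le (by norm_num) ht)) (fun t ht => ?_)
      (tendsto_heatKernel_atTop 1)
    have ht0 : 1 / 2 < t := ht
    refine mul_nonpos_of_nonneg_of_nonpos (heatKernel_nonneg _ _) ?_
    rw [sub_nonpos]
    apply one_div_le_one_div_of_le (by positivity)
    nlinarith

theorem integral_kernelDeriv {t : ℝ} (ht : 0 ≤ t) :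
    ∫ s in (0 : ℝ)..t, kernelDeriv s = heatKernel t 1 := by
  rw [intervalIntegral.integral_eq_sub_of_hasDerivAt_of_le ht (f := fun s => heatKernel s 1)
    ?_ (fun s hs => hasDerivAt_heatKernel_one hs.1) ?_]
  · simp [heatKernel_of_nonpos le_rfl]
  · intro s hs
    rcases hs.1.eq_or_lt with h | h
    · rw [← h]; exact continuousAt_heatKernel_one_zero.continuousWithinAt
    · exact (hasDerivAt_heatKernel_one h).continuousAt.continuousWithinAt
  · rw [intervalIntegrable_iff_integrableOn_Ioc_of_le ht]
    exact integrableOn_kernelDeriv.mono_set Ioc_subset_Ioi_self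

/-! ### Laplace transforms of the kernels on the positive reals -/

/-- The antiderivatives below involve `y / (2√t)`, whose value at `0` is meaningless. Only the right
limit is required, and `F` is replaced by `0` on the nonpositive axis. -/
theorem integral_Ioi_of_hasDerivAt_of_tendsto_zero {F f : ℝ → ℝ} {m : ℝ}
    (hderiv : ∀ t, 0 < t → HasDerivAt F (f t) t) (hf : ∀ t, 0 < t → 0 ≤ f t)
    (h0 : Tendsto F (𝓝[>] 0) (𝓝 0)) (hinf : Tendsto F atTop (𝓝 m)) :
    IntegrableOn f (Ioi 0) ∧ ∫ t in Ioi (0 : ℝ), f t = m := by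
  set G : ℝ → ℝ := fun t => if t ≤ 0 then 0 else F t with hG
  have hG0 : ContinuousWithinAt G (Ici 0) 0 := by
    rw [← Ioi_insert, continuousWithinAt_insert_self]
    have : G 0 = 0 := by simp [hG]
    unfold ContinuousWithinAt
    rw [this]
    refine h0.congr' ?_
    filter_upwards [self_mem_nhdsWithin] with t ht
    simp [hG, not_le.2 (mem_Ioi.1 ht)]
  have hGd : ∀ t ∈ Ioi (0 : ℝ), HasDerivAt G (f t) t := by
    intro t ht
    refine (hderiv t ht).congr_of_eventuallyEq ?_
    filter_upwards [Ioi_mem_nhds ht] with s hs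
    simp [hG, not_le.2 (mem_Ioi.1 hs)]
  have hGi : Tendsto G atTop (𝓝 m) := by
    refine hinf.congr' ?_
    filter_upwards [eventually_gt_atTop 0] with s hs
    simp [hG, not_le.2 hs]
  refine ⟨integrableOn_Ioi_deriv_of_nonneg hG0 hGd hf hGi, ?_⟩
  rw [integral_Ioi_of_hasDerivAt_of_nonneg hG0 hGd hf hGi]
  simp [hG]

/-- The distribution function of the normalised Gaussian `exp (-u²) / √π`. -/
def gaussCDF (z : ℝ) : ℝ := (∫ u in Iic z, Real.exp (-u ^ 2)) / Real.sqrt Real.pi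

theorem integrable_exp_neg_sq : Integrable fun u : ℝ => Real.exp (-u ^ 2) := by
  simpa using integrable_exp_neg_mul_sq (b := 1) one_pos

theorem hasDerivAt_gaussCDF (z : ℝ) :
    HasDerivAt gaussCDF (Real.exp (-z ^ 2) / Real.sqrt Real.pi) z := by
  unfold gaussCDF
  refine HasDerivAt.div_const ?_ _
  have h : ∀ y : ℝ, ∫ u in Iic y, Real.exp (-u ^ 2) =
      (∫ u in Iic (0 : ℝ), Real.exp (-u ^ 2)) + ∫ u in (0 : ℝ)..y, Real.exp (-u ^ 2) := by
    intro y
    rw [← intervalIntegral.integral_Iic_sub_Iic integrable_exp_neg_sq.integrableOn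
      integrable_exp_neg_sq.integrableOn]
    ring
  rw [funext h]
  refine HasDerivAt.const_add _ ?_
  exact Continuous.deriv_integral (fun u : ℝ => Real.exp (-u ^ 2)) (by fun_prop) 0 z ▸
    (intervalIntegral.differentiable_integral_of_continuous (by fun_prop) z).hasDerivAt

theorem tendsto_gaussCDF_atBot : Tendsto gaussCDF atBot (𝓝 0) := by
  have h := (tendsto_integral_Iic_zero (f := fun u : ℝ => Real.exp (-u ^ 2)) (μ := volume)
    (a := fun z : ℝ => z) tendsto_id).div_const (Real.sqrt Real.pi)
  rw [zero_div] at h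
  exact h

theorem gaussCDF_add_integral_Ioi (z : ℝ) :
    gaussCDF z + (∫ u in Ioi z, Real.exp (-u ^ 2)) / Real.sqrt Real.pi = 1 := by
  have hpi : Real.sqrt Real.pi ≠ 0 := (Real.sqrt_pos.2 Real.pi_pos).ne'
  have h := intervalIntegral.integral_Iic_add_Ioi (b := z) (μ := volume)
    integrable_exp_neg_sq.integrableOn integrable_exp_neg_sq.integrableOn
  have h2 := integral_gaussian 1
  simp only [neg_mul, one_mul, div_one] at h2
  rw [gaussCDF, ← add_div, h, h2, div_self hpi]

theorem tendsto_gaussCDF_atTop : Tendsto gaussCDF atTop (𝓝 1) := by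
  have h := (tendsto_integral_Ioi_zero (f := fun u : ℝ => Real.exp (-u ^ 2)) (μ := volume)
    (b := fun z : ℝ => z) tendsto_id).div_const (Real.sqrt Real.pi)
  have h2 := h.const_sub 1
  simp only [zero_div, sub_zero] at h2
  refine h2.congr fun z => ?_
  rw [← gaussCDF_add_integral_Ioi z]; ring

theorem gaussCDF_zero : gaussCDF 0 = 1 / 2 := by
  have hpi : Real.sqrt Real.pi ≠ 0 := (Real.sqrt_pos.2 Real.pi_pos).ne'
  have h := gaussCDF_add_integral_Ioi 0
  have h2 := integral_gaussian_Ioi 1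
  simp only [neg_mul, one_mul, div_one] at h2
  rw [h2, div_right_comm, div_self hpi] at h
  linarith

/-- The first passage density `(y / t) K(t, y)`, the inverse Laplace transform of
`exp (-y √s)`. -/
def passageDensity (y t : ℝ) : ℝ := y / t * heatKernel t y

theorem passageDensity_nonneg {y t : ℝ} (hy : 0 ≤ y) (ht : 0 ≤ t) : 0 ≤ passageDensity y t :=
  mul_nonneg (div_nonneg hy ht) (heatKernel_nonneg t y)

section Antiderivative

variable {y w : ℝ}

theorem tendsto_div_two_sqrt_zero (hy : 0 < y) :
    Tendsto (fun t => y / (2 * Real.sqrt t)) (𝓝[>] 0) atTop := by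
  have h : Tendsto (fun t => Real.sqrt t) (𝓝[>] 0) (𝓝[>] 0) := by
    refine tendsto_nhdsWithin_iff.2 ⟨?_, ?_⟩
    · have : ContinuousAt Real.sqrt 0 := by fun_prop
      simpa [ContinuousAt] using this.tendsto.mono_left nhdsWithin_le_nhds
    · filter_upwards [self_mem_nhdsWithin] with t ht
      exact Real.sqrt_pos.2 ht
  have h2 := (tendsto_inv_nhdsGT_zero.comp h).const_mul_atTop (show 0 < y / 2 by positivity)
  refine h2.congr fun t => ?_
  simp only [Function.comp]; ring

theorem tendsto_mul_sqrt_zero (w : ℝ) :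
    Tendsto (fun t => w * Real.sqrt t) (𝓝[>] 0) (𝓝 0) := by
  have : ContinuousAt (fun t => w * Real.sqrt t) 0 := by fun_prop
  simpa [ContinuousAt] using this.tendsto.mono_left nhdsWithin_le_nhds

theorem tendsto_div_two_sqrt_atTop (y : ℝ) :
    Tendsto (fun t => y / (2 * Real.sqrt t)) atTop (𝓝 0) := by
  have h := (tendsto_inv_atTop_zero.comp Real.tendsto_sqrt_atTop).const_mul (y / 2)
  simp only [mul_zero] at h
  refine h.congr fun t => ?_
  simp only [Function.comp]; ring

/-- Completing the square: `(σw√t - y/(2√t))² = w²t - σyw + y²/(4t)`, and the prefactor cancels the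
cross term. The sum of the cases `σ = 1` and `σ = -1` is an antiderivative for the passage density,
their difference one for the heat kernel. -/
theorem hasDerivAt_gaussCDF_comp (y w : ℝ) {t : ℝ} (ht : 0 < t) (σ : ℝ) (hσ : σ ^ 2 = 1) :
    HasDerivAt (fun s => Real.exp (-(σ * (y * w))) *
        gaussCDF (σ * (w * Real.sqrt s) - y / (2 * Real.sqrt s)))
      ((σ * w + y / (2 * t)) * heatKernel t y * Real.exp (-(w ^ 2 * t))) t := by
  have hs := Real.sqrt_pos.2 ht
  have hsq := Real.sq_sqrt ht.le
  have h1 := Real.hasDerivAt_sqrt ht.ne'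
  have h2 : HasDerivAt (fun s => σ * (w * Real.sqrt s) - y / (2 * Real.sqrt s))
      (σ * (w * (1 / (2 * Real.sqrt t))) + y / (4 * t * Real.sqrt t)) t := by
    have h3 := ((h1.const_mul w).const_mul σ).sub
      (((h1.const_mul 2).inv (by positivity)).const_mul y)
    convert! h3 using 1
    rw [mul_pow, hsq]
    field_simp
    ring
  have h := (((hasDerivAt_gaussCDF _).comp t h2)).const_mul (Real.exp (-(σ * (y * w))))
  convert! h using 1
  have hE : Real.exp (-(σ * (w * Real.sqrt t) - y / (2 * Real.sqrt t)) ^ 2) =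
      Real.exp (-(w ^ 2 * t)) * Real.exp (-(y ^ 2 / (4 * t))) * Real.exp (σ * (y * w)) := by
    rw [← Real.exp_add, ← Real.exp_add]
    congr 1
    have : (σ * (w * Real.sqrt t) - y / (2 * Real.sqrt t)) ^ 2 =
      σ ^ 2 * w ^ 2 * Real.sqrt t ^ 2 - σ * (y * w) + y ^ 2 / (4 * Real.sqrt t ^ 2) := by
        field_simp; ring
    rw [this, hsq, hσ]; ring
  rw [hE, Real.exp_neg (σ * (y * w))]
  unfold heatKernel
  have h4 : Real.sqrt (4 * Real.pi * t) = 2 * Real.sqrt Real.pi * Real.sqrt t := by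
    rw [Real.sqrt_mul (by positivity), Real.sqrt_mul (by positivity),
      show (4 : ℝ) = 2 ^ 2 by norm_num, Real.sqrt_sq (by norm_num)]
  rw [h4]
  have := Real.sqrt_pos.2 Real.pi_pos
  have := Real.exp_pos (σ * (y * w))
  field_simp
  ring

/-- At `0` both arguments of `gaussCDF` tend to `-∞`. At infinity they tend to `+∞` for `σ = 1` and
to `-∞` for `σ = -1`, so only `exp(-yw)` survives. -/
theorem laplace_passageDensity (hy : 0 < y) (hw : 0 < w) :
    IntegrableOn (fun t => passageDensity y t * Real.exp (-(w ^ 2 * t))) (Ioi 0) ∧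
      ∫ t in Ioi (0 : ℝ), passageDensity y t * Real.exp (-(w ^ 2 * t)) = Real.exp (-(y * w)) := by
  refine integral_Ioi_of_hasDerivAt_of_tendsto_zero
    (F := fun s => Real.exp (-(1 * (y * w))) *
        gaussCDF (1 * (w * Real.sqrt s) - y / (2 * Real.sqrt s)) + Real.exp (-(-1 * (y * w))) *
        gaussCDF (-1 * (w * Real.sqrt s) - y / (2 * Real.sqrt s))) (fun t ht => ?_)
    (fun t ht => mul_nonneg (passageDensity_nonneg hy.le ht.le) (Real.exp_pos _).le) ?_ ?_
  · convert! (hasDerivAt_gaussCDF_comp y w ht 1 (by norm_num)).add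
      (hasDerivAt_gaussCDF_comp y w ht (-1) (by norm_num)) using 1
    unfold passageDensity; field_simp; ring
  · have h (σ : ℝ) : Tendsto (fun s => Real.exp (-(σ * (y * w))) *
        gaussCDF (σ * (w * Real.sqrt s) - y / (2 * Real.sqrt s))) (𝓝[>] 0) (𝓝 0) := by
      have h1 : Tendsto (fun s => σ * (w * Real.sqrt s) - y / (2 * Real.sqrt s)) (𝓝[>] 0) atBot :=
        ((tendsto_mul_sqrt_zero w).const_mul σ).add_atBot
          (tendsto_neg_atTop_atBot.comp (tendsto_div_two_sqrt_zero hy))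
      simpa using (tendsto_gaussCDF_atBot.comp h1).const_mul (Real.exp (-(σ * (y * w))))
    simpa using (h 1).add (h (-1))
  · have h0 : Tendsto (fun s => w * Real.sqrt s) atTop atTop :=
      Real.tendsto_sqrt_atTop.const_mul_atTop hw
    have h1 : Tendsto (fun s => 1 * (w * Real.sqrt s) - y / (2 * Real.sqrt s)) atTop atTop := by
      simpa [sub_eq_add_neg] using h0.atTop_add (tendsto_div_two_sqrt_atTop y).neg
    have h2 : Tendsto (fun s => -1 * (w * Real.sqrt s) - y / (2 * Real.sqrt s)) atTop atBot := by
      simpa [sub_eq_add_neg] using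
        (tendsto_neg_atTop_atBot.comp h0).atBot_add (tendsto_div_two_sqrt_atTop y).neg
    simpa using ((tendsto_gaussCDF_atTop.comp h1).const_mul (Real.exp (-(1 * (y * w))))).add
      ((tendsto_gaussCDF_atBot.comp h2).const_mul (Real.exp (-(-1 * (y * w)))))

/-- For `w = 0` the two branches coincide, whence the factor `2`; the limit at infinity is `2 ·
gaussCDF 0 = 1`. -/
theorem integral_passageDensity (hy : 0 < y) :
    IntegrableOn (passageDensity y) (Ioi 0) ∧ ∫ t in Ioi (0 : ℝ), passageDensity y t = 1 := by
  refine integral_Ioi_of_hasDerivAt_of_tendsto_zero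
    (F := fun s => 2 * (Real.exp (-(1 * (y * 0))) *
        gaussCDF (1 * (0 * Real.sqrt s) - y / (2 * Real.sqrt s)))) (fun t ht => ?_)
    (fun t ht => passageDensity_nonneg hy.le ht.le) ?_ ?_
  · convert! (hasDerivAt_gaussCDF_comp y 0 ht 1 (by norm_num)).const_mul 2 using 1
    simp [passageDensity]; ring
  · have h1 : Tendsto (fun s => - (y / (2 * Real.sqrt s))) (𝓝[>] 0) atBot :=
      tendsto_neg_atTop_atBot.comp (tendsto_div_two_sqrt_zero hy)
    simpa using (tendsto_gaussCDF_atBot.comp h1).const_mul 2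
  · have h1 := (hasDerivAt_gaussCDF 0).continuousAt.tendsto.comp
      (by simpa using (tendsto_div_two_sqrt_atTop y).neg)
    simpa [gaussCDF_zero] using h1.const_mul 2

theorem laplace_heatKernel (hy : 0 < y) (hw : 0 < w) :
    IntegrableOn (fun t => heatKernel t y * Real.exp (-(w ^ 2 * t))) (Ioi 0) ∧
      ∫ t in Ioi (0 : ℝ), heatKernel t y * Real.exp (-(w ^ 2 * t)) =
        Real.exp (-(y * w)) / (2 * w) := by
  refine integral_Ioi_of_hasDerivAt_of_tendsto_zero
    (F := fun s => (Real.exp (-(1 * (y * w))) *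
        gaussCDF (1 * (w * Real.sqrt s) - y / (2 * Real.sqrt s)) - Real.exp (-(-1 * (y * w))) *
        gaussCDF (-1 * (w * Real.sqrt s) - y / (2 * Real.sqrt s))) / (2 * w)) (fun t ht => ?_)
    (fun t ht => mul_nonneg (heatKernel_nonneg t y) (Real.exp_pos _).le) ?_ ?_
  · convert! ((hasDerivAt_gaussCDF_comp y w ht 1 (by norm_num)).sub
      (hasDerivAt_gaussCDF_comp y w ht (-1) (by norm_num))).div_const (2 * w) using 1
    field_simp; ring
  · have h (σ : ℝ) : Tendsto (fun s => Real.exp (-(σ * (y * w))) *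
        gaussCDF (σ * (w * Real.sqrt s) - y / (2 * Real.sqrt s))) (𝓝[>] 0) (𝓝 0) := by
      have h1 : Tendsto (fun s => σ * (w * Real.sqrt s) - y / (2 * Real.sqrt s)) (𝓝[>] 0) atBot :=
        ((tendsto_mul_sqrt_zero w).const_mul σ).add_atBot
          (tendsto_neg_atTop_atBot.comp (tendsto_div_two_sqrt_zero hy))
      simpa using (tendsto_gaussCDF_atBot.comp h1).const_mul (Real.exp (-(σ * (y * w))))
    simpa using ((h 1).sub (h (-1))).div_const (2 * w)
  · have h0 : Tendsto (fun s => w * Real.sqrt s) atTop atTop :=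
      Real.tendsto_sqrt_atTop.const_mul_atTop hw
    have h1 : Tendsto (fun s => 1 * (w * Real.sqrt s) - y / (2 * Real.sqrt s)) atTop atTop := by
      simpa [sub_eq_add_neg] using h0.atTop_add (tendsto_div_two_sqrt_atTop y).neg
    have h2 : Tendsto (fun s => -1 * (w * Real.sqrt s) - y / (2 * Real.sqrt s)) atTop atBot := by
      simpa [sub_eq_add_neg] using
        (tendsto_neg_atTop_atBot.comp h0).atBot_add (tendsto_div_two_sqrt_atTop y).neg
    simpa using (((tendsto_gaussCDF_atTop.comp h1).const_mul (Real.exp (-(1 * (y * w))))).sub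
      ((tendsto_gaussCDF_atBot.comp h2).const_mul (Real.exp (-(-1 * (y * w)))))).div_const (2 * w)

end Antiderivative

/-! ### The fundamental solution of the delay equation `Y' = -a Y(· - 1)` -/

/-- Picard iterates for the delay equation. -/
def delayIter (a : ℝ) : ℕ → ℝ → ℝ
  | 0 => fun _ => 1
  | n + 1 => fun x => 1 - a * ∫ z in (0 : ℝ)..max (x - 1) 0, delayIter a n z

/-- The solution of `Y' = -a Y(· - 1)` with `Y = 1` on `(-∞, 1]`, the equation holding
for arguments greater than `1`. -/
def delaySol (a x : ℝ) : ℝ := delayIter a ⌊x⌋₊ x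

theorem continuous_delayIter (a : ℝ) (n : ℕ) : Continuous (delayIter a n) := by
  induction n with
  | zero => exact continuous_const
  | succ n ih =>
    have h : Continuous fun y => ∫ z in (0 : ℝ)..y, delayIter a n z :=
      (intervalIntegral.differentiable_integral_of_continuous ih).continuous
    have h2 : Continuous fun x => ∫ z in (0 : ℝ)..max (x - 1) 0, delayIter a n z :=
      h.comp (by fun_prop)
    exact continuous_const.sub (continuous_const.mul h2)

/-- Method of steps: for `x ≤ n + 1` the integral only sees arguments up to `n`, where the previous
iterates already agree. -/
theorem delayIter_succ_eq (a : ℝ) (n : ℕ) {x : ℝ} (hx : x ≤ n + 1) :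
    delayIter a (n + 1) x = delayIter a n x := by
  induction n generalizing x with
  | zero =>
    have : max (x - 1) 0 = 0 := max_eq_right (by simpa using hx)
    simp [delayIter, this]
  | succ n ih =>
    change 1 - a * (∫ z in (0 : ℝ)..max (x - 1) 0, delayIter a (n + 1) z) =
      1 - a * ∫ z in (0 : ℝ)..max (x - 1) 0, delayIter a n z
    congr 2
    refine intervalIntegral.integral_congr fun z hz => ih ?_
    rw [uIcc_of_le (le_max_right _ _)] at hz
    refine hz.2.trans (max_le ?_ (by positivity))
    push_cast at hx; linarith

theorem delayIter_eq_of_le (a : ℝ) {n m : ℕ} (hnm : n ≤ m) {x : ℝ} (hx : x ≤ n + 1) :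
    delayIter a m x = delayIter a n x := by
  induction m, hnm using Nat.le_induction with
  | base => rfl
  | succ m hm ih =>
    rw [delayIter_succ_eq a m, ih]
    have : (n : ℝ) ≤ m := by exact_mod_cast hm
    linarith

theorem delaySol_eq_delayIter (a : ℝ) (n : ℕ) {x : ℝ} (hx : x ≤ n + 1) :
    delaySol a x = delayIter a n x := by
  unfold delaySol
  rcases le_total n ⌊x⌋₊ with h | h
  · exact delayIter_eq_of_le a h hx
  · exact (delayIter_eq_of_le a h (Nat.lt_floor_add_one x).le).symm

theorem continuous_delaySol (a : ℝ) : Continuous (delaySol a) := by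
  refine continuous_iff_continuousAt.2 fun x => ?_
  obtain ⟨n, hn⟩ := exists_nat_gt x
  refine (continuous_delayIter a n).continuousAt.congr ?_
  filter_upwards [Iio_mem_nhds hn] with y hy
  exact (delaySol_eq_delayIter a n (by linarith [mem_Iio.1 hy])).symm

theorem delaySol_eq_integral (a x : ℝ) :
    delaySol a x = 1 - a * ∫ z in (0 : ℝ)..max (x - 1) 0, delaySol a z := by
  obtain ⟨n, hn⟩ := exists_nat_gt x
  rw [delaySol_eq_delayIter a (n + 1) (by push_cast; linarith)]
  change 1 - a * (∫ z in (0 : ℝ)..max (x - 1) 0, delayIter a n z) = _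
  congr 2
  refine intervalIntegral.integral_congr fun z hz => (delaySol_eq_delayIter a n ?_).symm
  rw [uIcc_of_le (le_max_right _ _)] at hz
  exact hz.2.trans (max_le (by linarith) (by positivity))

theorem delaySol_of_le_one (a : ℝ) {x : ℝ} (hx : x ≤ 1) : delaySol a x = 1 := by
  rw [delaySol_eq_integral, max_eq_right (by linarith)]; simp

theorem hasDerivAt_delaySol (a : ℝ) {x : ℝ} (hx : 1 < x) :
    HasDerivAt (delaySol a) (-(a * delaySol a (x - 1))) x := by
  have h1 : HasDerivAt (fun y => ∫ z in (0 : ℝ)..y, delaySol a z) (delaySol a (x - 1)) (x - 1) :=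
    intervalIntegral.integral_hasDerivAt_right ((continuous_delaySol a).intervalIntegrable _ _)
      ((continuous_delaySol a).stronglyMeasurableAtFilter _ _) (continuous_delaySol a).continuousAt
  have h2 := ((h1.comp x ((hasDerivAt_id x).sub_const 1)).const_mul a).const_sub 1
  simp only [mul_one] at h2
  refine h2.congr_of_eventuallyEq ?_
  filter_upwards [Ioi_mem_nhds hx] with y hy
  rw [delaySol_eq_integral, max_eq_left (by linarith [mem_Ioi.1 hy])]
  rfl

/-- At `a = 1/e` the characteristic equation `λ + a exp(-λ) = 0` has the double root `-1`, hence the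
comparison with `exp(-x)`. Suppose `exp(x) Y(x)` increases on `[0, c]` and put `G = exp(c) Y(c)`. On
`[c, c+1]` one has `a Y(x-1) ≤ (a e) exp(-x) G ≤ exp(-x) G`. Thus `Y' ≥ (exp(-x) G)'` with equality
of the functions at `c`, so `Y ≥ exp(-x) G ≥ a Y(x-1)`, and this says that the derivative of `exp(x)
Y(x)` is nonnegative. -/
theorem monotoneOn_exp_mul_delaySol {a : ℝ} (ha : 0 < a) (hae : a ≤ Real.exp (-1)) (n : ℕ) :
    MonotoneOn (fun x => Real.exp x * delaySol a x) (Icc 0 (n + 1)) := by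
  have hcont := continuous_delaySol a
  have hae1 : a * Real.exp 1 ≤ 1 := by
    rw [Real.exp_neg] at hae
    calc a * Real.exp 1 ≤ (Real.exp 1)⁻¹ * Real.exp 1 := by gcongr
      _ = 1 := inv_mul_cancel₀ (Real.exp_pos 1).ne'
  induction n with
  | zero =>
    intro x hx y hy hxy
    simp only [Nat.cast_zero, zero_add] at hx hy
    simpa [delaySol_of_le_one a hx.2, delaySol_of_le_one a hy.2] using hxy
  | succ n ih =>
    have hn : (0 : ℝ) ≤ n := n.cast_nonneg
    set c : ℝ := n + 1 with hc
    set G : ℝ := Real.exp c * delaySol a c with hG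
    have hG0 : 0 ≤ G := by
      have h := ih (a := 0) (b := c) ⟨le_rfl, by linarith⟩ ⟨by linarith, le_rfl⟩ (by linarith)
      simp only [Real.exp_zero, delaySol_of_le_one a zero_le_one] at h
      linarith
    have hdelay : ∀ x ∈ Icc c (c + 1), a * delaySol a (x - 1) ≤ Real.exp (-x) * G := by
      intro x hx
      have h := ih (a := x - 1) (b := c) ⟨by linarith [hx.1], by linarith [hx.2]⟩
        ⟨by linarith, le_rfl⟩ (by linarith [hx.2])
      simp only at h
      have h2 : delaySol a (x - 1) = Real.exp (-x) * Real.exp 1 *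
          (Real.exp (x - 1) * delaySol a (x - 1)) := by
        rw [← mul_assoc, ← Real.exp_add, ← Real.exp_add]
        have : -x + 1 + (x - 1) = 0 := by ring
        rw [this]; simp
      rw [h2]
      calc a * (Real.exp (-x) * Real.exp 1 * (Real.exp (x - 1) * delaySol a (x - 1)))
          ≤ a * (Real.exp (-x) * Real.exp 1 * G) := by gcongr
        _ = (a * Real.exp 1) * (Real.exp (-x) * G) := by ring
        _ ≤ 1 * (Real.exp (-x) * G) := by gcongr
        _ = _ := one_mul _
    have hge : ∀ x ∈ Icc c (c + 1), Real.exp (-x) * G ≤ delaySol a x := by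
      have hm : MonotoneOn (fun x => delaySol a x - Real.exp (-x) * G) (Icc c (c + 1)) := by
        refine monotoneOn_of_hasDerivWithinAt_nonneg (convex_Icc _ _) (by fun_prop)
          (f' := fun x => -(a * delaySol a (x - 1)) - (-Real.exp (-x)) * G)
          (fun x hx => ?_) (fun x hx => ?_)
        · rw [interior_Icc] at hx
          refine (HasDerivAt.sub (hasDerivAt_delaySol a (by linarith [hx.1])) ?_).hasDerivWithinAt
          have := ((hasDerivAt_id x).neg.exp).mul_const G
          simpa using this
        · rw [interior_Icc] at hx
          have := hdelay x ⟨hx.1.le, hx.2.le⟩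
          linarith
      intro x hx
      have h := hm ⟨le_rfl, by linarith⟩ hx hx.1
      simp only at h
      have h0 : Real.exp (-c) * G = delaySol a c := by
        rw [hG, ← mul_assoc, ← Real.exp_add]; simp
      linarith
    have hm : MonotoneOn (fun x => Real.exp x * delaySol a x) (Icc c (c + 1)) := by
      refine monotoneOn_of_hasDerivWithinAt_nonneg (convex_Icc _ _) (by fun_prop)
          (f' := fun x => Real.exp x * delaySol a x + Real.exp x * -(a * delaySol a (x - 1)))
          (fun x hx => ?_) (fun x hx => ?_)
      · rw [interior_Icc] at hx
        exact ((Real.hasDerivAt_exp x).mul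
          (hasDerivAt_delaySol a (by linarith [hx.1]))).hasDerivWithinAt
      · rw [interior_Icc] at hx
        have h1 := hdelay x ⟨hx.1.le, hx.2.le⟩
        have h2 := hge x ⟨hx.1.le, hx.2.le⟩
        rw [← mul_add]
        exact mul_nonneg (Real.exp_pos x).le (by linarith)
    have hu := ih.union_right hm (c := c) ⟨⟨by linarith, le_rfl⟩, fun x hx => hx.2⟩
      ⟨⟨le_rfl, by linarith⟩, fun x hx => hx.1⟩
    rw [Icc_union_Icc_eq_Icc (by linarith) (by linarith)] at hu
    push_cast
    exact hu

section DelayEquation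

variable {a : ℝ}

theorem delaySol_nonneg (ha : 0 < a) (hae : a ≤ Real.exp (-1)) (x : ℝ) : 0 ≤ delaySol a x := by
  rcases le_or_gt x 1 with h | h
  · simp [delaySol_of_le_one a h]
  obtain ⟨n, hn⟩ := exists_nat_gt x
  have h := monotoneOn_exp_mul_delaySol ha hae n ⟨le_rfl, by positivity⟩
    (show x ∈ Icc (0 : ℝ) (n + 1) from ⟨by linarith, by linarith⟩) (by linarith)
  simp only [Real.exp_zero, delaySol_of_le_one a zero_le_one] at h
  have h2 : 0 < Real.exp x * delaySol a x := by linarith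
  exact (pos_of_mul_pos_right h2 (Real.exp_pos x).le).le

theorem delaySol_le_one (ha : 0 < a) (hae : a ≤ Real.exp (-1)) (x : ℝ) : delaySol a x ≤ 1 := by
  rw [delaySol_eq_integral]
  have : 0 ≤ ∫ z in (0 : ℝ)..max (x - 1) 0, delaySol a z :=
    intervalIntegral.integral_nonneg (le_max_right _ _) fun z _ => delaySol_nonneg ha hae z
  nlinarith

/-- The integrated equation reads `a ∫₀ˣ Y = 1 - Y(x+1)`, which is at most `1` since `Y ≥ 0`. -/
theorem integrableOn_delaySol (ha : 0 < a) (hae : a ≤ Real.exp (-1)) :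
    IntegrableOn (delaySol a) (Ioi 0) := by
  refine integrableOn_Ioi_of_intervalIntegral_norm_bounded (1 / a) 0 (b := fun z : ℝ => z)
    (fun x => (continuous_delaySol a).integrableOn_Ioc) tendsto_id ?_
  filter_upwards [eventually_gt_atTop 0] with x hx
  simp only [Real.norm_of_nonneg (delaySol_nonneg ha hae _)]
  have h := delaySol_eq_integral a (x + 1)
  have h2 := delaySol_nonneg ha hae (x + 1)
  rw [show x + 1 - 1 = x by ring, max_eq_left hx.le] at h
  rw [le_div_iff₀ ha]
  linarith

theorem laplace_delaySol (ha : 0 < a) (hae : a ≤ Real.exp (-1)) {w : ℝ} (hw : 0 < w) :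
    IntegrableOn (fun x => delaySol a x * Real.exp (-(x * w))) (Ioi 0) ∧
    ∫ x in Ioi (0 : ℝ), delaySol a x * Real.exp (-(x * w)) = 1 / (w + a * Real.exp (-w)) := by
  have hcont := continuous_delaySol a
  have hint : IntegrableOn (fun x => delaySol a x * Real.exp (-(x * w))) (Ioi 0) := by
    refine Integrable.mono' (integrableOn_delaySol ha hae)
      (Continuous.aestronglyMeasurable (by fun_prop)) ?_
    refine (ae_restrict_iff' measurableSet_Ioi).2 (ae_of_all _ fun x hx => ?_)
    have hx0 : 0 < x := hx
    have h0 := delaySol_nonneg ha hae x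
    rw [Real.norm_of_nonneg (by positivity)]
    exact mul_le_of_le_one_right h0 (Real.exp_le_one_iff.2 (by nlinarith))
  refine ⟨hint, ?_⟩
  set L := ∫ x in Ioi (0 : ℝ), delaySol a x * Real.exp (-(x * w)) with hL
  have hint1 := hint.mono_set (Ioi_subset_Ioi zero_le_one)
  have hind : (fun x => (Ioi (0 : ℝ)).indicator (fun x => delaySol a x * Real.exp (-(x * w)))
      (x - 1)) = (Ioi (1 : ℝ)).indicator
        (fun x => Real.exp w * (delaySol a (x - 1) * Real.exp (-(x * w)))) := by
    ext x
    by_cases hx : 1 < x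
    · rw [indicator_of_mem (mem_Ioi.2 (sub_pos.2 hx)), indicator_of_mem (mem_Ioi.2 hx),
        mul_left_comm, ← Real.exp_add]
      ring_nf
    · rw [indicator_of_notMem (by simpa using hx), indicator_of_notMem (by simpa using hx)]
  have hexp : Real.exp (-w) * Real.exp w = 1 := by rw [← Real.exp_add]; simp
  have hshift_int : IntegrableOn (fun x => delaySol a (x - 1) * Real.exp (-(x * w))) (Ioi 1) := by
    have h := (integrable_indicator_iff measurableSet_Ioi).2 hint |>.comp_sub_right 1
    rw [hind, integrable_indicator_iff measurableSet_Ioi] at h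
    have h2 := h.const_mul (Real.exp (-w))
    simp only [← mul_assoc, hexp, one_mul] at h2
    exact h2
  have hshift : ∫ x in Ioi (1 : ℝ), delaySol a (x - 1) * Real.exp (-(x * w)) =
      Real.exp (-w) * L := by
    have h := integral_sub_right_eq_self (μ := volume)
      ((Ioi (0 : ℝ)).indicator fun x => delaySol a x * Real.exp (-(x * w))) (1 : ℝ)
    rw [hind, integral_indicator measurableSet_Ioi, integral_indicator measurableSet_Ioi,
      integral_const_mul] at h
    rw [hL, ← h, ← mul_assoc, hexp, one_mul]
  have hfirst : ∫ x in (0 : ℝ)..1, delaySol a x * Real.exp (-(x * w)) =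
      (1 - Real.exp (-w)) / w := by
    have h1 : ∫ x in (0 : ℝ)..1, delaySol a x * Real.exp (-(x * w)) =
        ∫ x in (0 : ℝ)..1, Real.exp (-(x * w)) := by
      refine intervalIntegral.integral_congr fun x hx => ?_
      rw [uIcc_of_le zero_le_one] at hx
      simp [delaySol_of_le_one a hx.2]
    rw [h1, intervalIntegral.integral_eq_sub_of_hasDerivAt (f := fun x => -Real.exp (-(x * w)) / w)]
    · simp; ring
    · intro x _
      have h := (((hasDerivAt_id x).mul_const w).neg.exp).neg.div_const w
      convert! h using 1
      simp; field_simp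
    · exact Continuous.intervalIntegrable (by fun_prop) _ _
  -- The delay equation holds only beyond `1`, so the derivative of `Y(x) exp(-xw)` is integrated
  -- over `(1, ∞)`. The delayed term turns into `exp(-w) L` by translation, and `(0, 1]`, where `Y =
  -- 1`, is computed explicitly.
  have htail : ∫ x in Ioi (1 : ℝ), (-(a * delaySol a (x - 1)) * Real.exp (-(x * w)) +
      delaySol a x * (Real.exp (-(x * w)) * (-w))) = 0 - delaySol a 1 * Real.exp (-(1 * w)) := by
    refine integral_Ioi_of_hasDerivAt_of_tendsto
      (f := fun x => delaySol a x * Real.exp (-(x * w))) ?_ (fun x hx => ?_) ?_ ?_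
    · exact Continuous.continuousWithinAt (by fun_prop)
    · refine (hasDerivAt_delaySol a hx).mul ?_
      have h := ((hasDerivAt_id x).mul_const w).neg.exp
      simpa using h
    · refine Integrable.add ?_ ?_
      · simpa [mul_assoc] using hshift_int.const_mul (-a)
      · simpa [mul_assoc] using hint1.mul_const (-w)
    · refine squeeze_zero (g := fun x => Real.exp (-(x * w))) (fun x => ?_) (fun x => ?_) ?_
      · exact mul_nonneg (delaySol_nonneg ha hae x) (Real.exp_pos _).le
      · exact mul_le_of_le_one_left (Real.exp_pos _).le (delaySol_le_one ha hae x)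
      · exact Real.tendsto_exp_neg_atTop_nhds_zero.comp (tendsto_id.atTop_mul_const hw)
  have hsplit : L = (∫ x in (0 : ℝ)..1, delaySol a x * Real.exp (-(x * w))) +
      ∫ x in Ioi (1 : ℝ), delaySol a x * Real.exp (-(x * w)) :=
    (intervalIntegral.integral_interval_add_Ioi hint hint1).symm
  rw [integral_add] at htail
  · have e1 : ∫ x in Ioi (1 : ℝ), -(a * delaySol a (x - 1)) * Real.exp (-(x * w)) =
        -a * (Real.exp (-w) * L) := by
      rw [← hshift, ← integral_const_mul]; congr 1; ext x; ring
    have e2 : ∫ x in Ioi (1 : ℝ), delaySol a x * (Real.exp (-(x * w)) * (-w)) =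
        -w * ∫ x in Ioi (1 : ℝ), delaySol a x * Real.exp (-(x * w)) := by
      rw [← integral_const_mul]; congr 1; ext x; ring
    rw [e1, e2, delaySol_of_le_one a le_rfl, one_mul, one_mul] at htail
    rw [hfirst] at hsplit
    have h3 : 0 < w + a * Real.exp (-w) := by positivity
    rw [eq_div_iff h3.ne']
    have h4 : w * ((1 - Real.exp (-w)) / w) = 1 - Real.exp (-w) := by field_simp
    have h5 : w * L = (1 - Real.exp (-w)) +
        w * ∫ x in Ioi (1 : ℝ), delaySol a x * Real.exp (-(x * w)) := by
      rw [← h4, ← mul_add, ← hsplit]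
    linarith
  · simpa [mul_assoc] using hshift_int.const_mul (-a)
  · simpa [mul_assoc] using hint1.mul_const (-w)

end DelayEquation

/-! ### Uniqueness of the Laplace transform -/

/-- A continuous function on `[0, 1]` all of whose moments vanish is zero. -/
theorem eq_zero_of_moments_eq_zero {G : ℝ → ℝ} (hG : Continuous G)
    (h : ∀ m : ℕ, ∫ x in (0 : ℝ)..1, x ^ m * G x = 0) {x : ℝ} (hx : x ∈ Icc (0 : ℝ) 1) :
    G x = 0 := by
  have hpoly : ∀ P : Polynomial ℝ, ∫ x in (0 : ℝ)..1, P.eval x * G x = 0 := by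
    intro P
    induction P using Polynomial.induction_on' with
    | add p q hp hq =>
      simp only [Polynomial.eval_add, add_mul]
      rw [intervalIntegral.integral_add, hp, hq, add_zero]
      · exact Continuous.intervalIntegrable (by fun_prop) _ _
      · exact Continuous.intervalIntegrable (by fun_prop) _ _
    | monomial n c =>
      simp only [Polynomial.eval_monomial, mul_assoc]
      rw [intervalIntegral.integral_const_mul, h n, mul_zero]
  have hle : ∀ ε > 0, ∫ x in (0 : ℝ)..1, G x ^ 2 ≤ ε * ∫ x in (0 : ℝ)..1, |G x| := by
    intro ε hε
    obtain ⟨P, hP⟩ := exists_polynomial_near_of_continuousOn 0 1 G hG.continuousOn ε hε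
    -- Subtracting a polynomial multiple of `G` costs nothing, since `G` is orthogonal to
    -- polynomials.
    have h1 : ∫ x in (0 : ℝ)..1, G x ^ 2 = ∫ x in (0 : ℝ)..1, (G x ^ 2 - P.eval x * G x) := by
      rw [intervalIntegral.integral_sub, hpoly P, sub_zero]
      · exact Continuous.intervalIntegrable (by fun_prop) _ _
      · exact Continuous.intervalIntegrable (by fun_prop) _ _
    rw [h1, ← intervalIntegral.integral_const_mul]
    refine intervalIntegral.integral_mono_on zero_le_one
      (Continuous.intervalIntegrable (by fun_prop) _ _)
      (Continuous.intervalIntegrable (by fun_prop) _ _) fun x hx => ?_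
    calc G x ^ 2 - P.eval x * G x ≤ |G x ^ 2 - P.eval x * G x| := le_abs_self _
      _ = |P.eval x - G x| * |G x| := by rw [← abs_mul, abs_sub_comm]; congr 1; ring
      _ ≤ ε * |G x| := by gcongr; exact (hP x hx).le
  have hle0 : ∫ x in (0 : ℝ)..1, G x ^ 2 ≤ 0 := by
    have ht : Tendsto (fun ε : ℝ => ε * ∫ x in (0 : ℝ)..1, |G x|) (𝓝[>] 0) (𝓝 0) := by
      have : Continuous fun ε : ℝ => ε * ∫ x in (0 : ℝ)..1, |G x| := by fun_prop
      simpa using (this.tendsto 0).mono_left nhdsWithin_le_nhds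
    exact ge_of_tendsto ht (eventually_nhdsWithin_of_forall fun ε hε => hle ε hε)
  by_contra hne
  have hpos : 0 < ∫ x in (0 : ℝ)..1, G x ^ 2 :=
    intervalIntegral.integral_pos zero_lt_one (by fun_prop) (fun x _ => sq_nonneg _)
      ⟨x, hx, by positivity⟩
  linarith

/-- If `F` is continuous and vanishes at `0` and at infinity, and its Laplace transform vanishes
at the positive integers, then `F = 0` on `[0, ∞)`. -/
theorem eq_zero_of_laplace_nat_eq_zero {F : ℝ → ℝ} (hF : Continuous F) (h0 : F 0 = 0)
    (hinf : Tendsto F atTop (𝓝 0))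
    (h : ∀ n : ℕ, Tendsto (fun T : ℝ => ∫ t in (0 : ℝ)..T, Real.exp (-((n + 1) * t)) * F t)
      atTop (𝓝 0)) {t : ℝ} (ht : 0 ≤ t) : F t = 0 := by
  -- The substitution `x = exp(-t)` turns Laplace integrals at positive integers into moments on
  -- `[0, 1]`.
  set G : ℝ → ℝ := fun x => F (-Real.log x) with hG
  have hGc : Continuous G := by
    refine continuous_iff_continuousAt.2 fun x => ?_
    rcases eq_or_ne x 0 with rfl | hx
    · rw [continuousAt_iff_punctured_nhds]
      -- As `log 0 = 0` by convention, `G 0` is `F 0`; the assumption `F 0 = 0` makes this agree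
      -- with the limit of `F` at infinity.
      have : G 0 = 0 := by simp [hG, h0]
      rw [this]
      exact hinf.comp (tendsto_neg_atBot_atTop.comp Real.tendsto_log_nhdsNE_zero)
    · exact hF.continuousAt.comp (Real.continuousAt_log hx).neg
  have hmom : ∀ m : ℕ, ∫ x in (0 : ℝ)..1, x ^ m * G x = 0 := by
    intro m
    have hsub : ∀ T : ℝ, ∫ t in (0 : ℝ)..T, Real.exp (-((m + 1) * t)) * F t =
        ∫ x in Real.exp (-T)..1, x ^ m * G x := by
      intro T
      have h1 := intervalIntegral.integral_comp_mul_deriv (a := 0) (b := T)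
        (f := fun t => Real.exp (-t)) (f' := fun t => -Real.exp (-t))
        (g := fun x => x ^ m * G x)
        (fun t _ => by simpa using (hasDerivAt_id t).neg.exp) (by fun_prop) (by fun_prop)
      have h2 : ∫ t in (0 : ℝ)..T, Real.exp (-((m + 1) * t)) * F t =
          -∫ t in (0 : ℝ)..T, ((fun x => x ^ m * G x) ∘ fun t => Real.exp (-t)) t *
            -Real.exp (-t) := by
        rw [← intervalIntegral.integral_neg]
        refine intervalIntegral.integral_congr fun t _ => ?_
        simp only [hG, Function.comp, Real.log_exp, neg_neg, ← Real.exp_nat_mul]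
        rw [show -((m + 1) * t) = m * -t + -t by ring, Real.exp_add]
        ring
      rw [h2, h1, neg_zero, Real.exp_zero, intervalIntegral.integral_symm, neg_neg]
    have hcont : Continuous fun z => ∫ x in (1 : ℝ)..z, x ^ m * G x :=
      (intervalIntegral.differentiable_integral_of_continuous (by fun_prop)).continuous
    have hlim := ((hcont.tendsto 0).comp Real.tendsto_exp_neg_atTop_nhds_zero).neg
    have hlim2 := h m
    simp only [hsub] at hlim2
    rw [intervalIntegral.integral_symm]
    refine tendsto_nhds_unique hlim (hlim2.congr fun T => ?_)
    simp only [Function.comp]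
    rw [intervalIntegral.integral_symm]
  have h2 := eq_zero_of_moments_eq_zero hGc hmom (x := Real.exp (-t))
    ⟨(Real.exp_pos _).le, Real.exp_le_one_iff.2 (by linarith)⟩
  simpa [hG] using h2

/-- Uniqueness of the Laplace transform: a locally integrable function whose improper Laplace
integrals vanish at all large real numbers is zero almost everywhere. -/
theorem ae_eq_zero_of_laplace_eq_zero {q : ℝ → ℝ} (hq : ∀ T, IntegrableOn q (Ioc 0 T)) {σ : ℝ}
    (h : ∀ s, σ < s → Tendsto (fun T : ℝ => ∫ t in (0 : ℝ)..T, Real.exp (-(s * t)) * q t)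
      atTop (𝓝 0)) : ∀ᵐ t ∂(volume.restrict (Ioi 0)), q t = 0 := by
  set s₀ := σ + 1 with hs₀
  set r : ℝ → ℝ := (Ioi (0 : ℝ)).indicator fun t => Real.exp (-(s₀ * t)) * q t with hr
  have hrint : ∀ a b : ℝ, IntervalIntegrable r volume a b := by
    intro a b
    rw [intervalIntegrable_iff, hr]
    have h1 : IntegrableOn (fun t => Real.exp (-(s₀ * t)) * q t) (Icc 0 (max a b)) := by
      refine IntegrableOn.continuousOn_mul (by fun_prop) ?_ isCompact_Icc
      rw [integrableOn_Icc_iff_integrableOn_Ioc]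
      exact hq _
    rw [IntegrableOn, integrable_indicator_iff measurableSet_Ioi, IntegrableOn,
      Measure.restrict_restrict measurableSet_Ioi]
    exact h1.mono_set fun t ht => ⟨(mem_Ioi.1 ht.1).le, ht.2.2⟩
  set F : ℝ → ℝ := fun t => ∫ u in (0 : ℝ)..t, r u with hF
  have hFc : Continuous F := intervalIntegral.continuous_primitive hrint 0
  have hr_eq : ∀ (g : ℝ → ℝ) (T : ℝ), 0 ≤ T → ∫ t in (0 : ℝ)..T, g t * r t =
      ∫ t in (0 : ℝ)..T, g t * (Real.exp (-(s₀ * t)) * q t) := by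
    intro g T hT
    rw [intervalIntegral.integral_of_le hT, intervalIntegral.integral_of_le hT]
    refine setIntegral_congr_fun measurableSet_Ioc fun t ht => ?_
    simp only [hr]
    rw [indicator_of_mem (mem_Ioi.2 ht.1)]
  have hFinf : Tendsto F atTop (𝓝 0) := by
    refine (h s₀ (by linarith)).congr' ?_
    filter_upwards [eventually_ge_atTop 0] with T hT
    simpa using (hr_eq (fun _ => 1) T hT).symm
  -- Integration by parts replaces the merely integrable `r` by its continuous primitive `F`, to
  -- which the moment argument applies.
  have hparts : ∀ (n : ℕ) (T : ℝ), ∫ t in (0 : ℝ)..T, Real.exp (-((n + 1) * t)) * r t =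
      Real.exp (-((n + 1) * T)) * F T +
        (n + 1) * ∫ t in (0 : ℝ)..T, Real.exp (-((n + 1) * t)) * F t := by
    intro n T
    have hd : ∀ t : ℝ, HasDerivAt (fun t : ℝ => Real.exp (-((n + 1) * t)))
        (-(n + 1) * Real.exp (-((n + 1) * t))) t := by
      intro t
      have := ((hasDerivAt_id t).const_mul ((n : ℝ) + 1)).neg.exp
      convert! this using 1
      simp; ring
    have hac : AbsolutelyContinuousOnInterval (fun t : ℝ => Real.exp (-((n + 1) * t))) 0 T :=
      ContDiffOn.absolutelyContinuousOnInterval (by fun_prop)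
    have hacF : AbsolutelyContinuousOnInterval F 0 T :=
      (hrint 0 T).absolutelyContinuousOnInterval_intervalIntegral left_mem_uIcc
    have hi := hac.integral_mul_deriv_eq_deriv_mul hacF
    have hderivF : ∫ t in (0 : ℝ)..T, Real.exp (-((n + 1) * t)) * deriv F t =
        ∫ t in (0 : ℝ)..T, Real.exp (-((n + 1) * t)) * r t := by
      refine intervalIntegral.integral_congr_ae ?_
      filter_upwards [(hrint 0 T).ae_hasDerivAt_integral] with t ht htm
      rw [(ht (uIoc_subset_uIcc htm) 0 left_mem_uIcc).deriv]
    rw [← hderivF, hi]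
    simp only [fun t => (hd t).deriv, mul_assoc, intervalIntegral.integral_const_mul]
    simp [hF]
    ring
  have hzero : ∀ t, 0 ≤ t → F t = 0 := by
    intro t ht
    refine eq_zero_of_laplace_nat_eq_zero hFc (by simp [hF]) hFinf (fun n => ?_) ht
    -- One factor `exp(-s₀ t)` is already contained in `r`, so the transform of `r` at `n + 1` is
    -- that of `q` at `s₀ + n + 1`.
    have h1 := h (s₀ + (n + 1)) (by rw [hs₀]; linarith [n.cast_nonneg (α := ℝ)])
    have h2 : Tendsto (fun T => Real.exp (-((n + 1) * T)) * F T) atTop (𝓝 0) := by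
      have h3 : Tendsto (fun T : ℝ => Real.exp (-((n + 1) * T))) atTop (𝓝 0) :=
        Real.tendsto_exp_neg_atTop_nhds_zero.comp (tendsto_id.const_mul_atTop (by positivity))
      simpa using h3.mul hFinf
    have h4 := (h1.sub h2).div_const ((n : ℝ) + 1)
    simp only [sub_zero, zero_div] at h4
    refine h4.congr' ?_
    filter_upwards [eventually_ge_atTop 0] with T hT
    have h5 := hparts n T
    rw [hr_eq _ T hT] at h5
    have h6 : ∀ t, Real.exp (-((s₀ + (n + 1)) * t)) * q t =
        Real.exp (-((n + 1) * t)) * (Real.exp (-(s₀ * t)) * q t) := by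
      intro t
      rw [← mul_assoc, ← Real.exp_add]; ring_nf
    simp only [h6]
    rw [h5, add_sub_cancel_left, mul_div_cancel_left₀ _ (by positivity)]
  have hloc : LocallyIntegrable r volume := by
    rw [locallyIntegrable_iff]
    intro K hK
    obtain ⟨R, hR⟩ := hK.isBounded.subset_closedBall 0
    rw [Real.closedBall_eq_Icc] at hR
    refine IntegrableOn.mono_set ?_ hR
    rw [integrableOn_Icc_iff_integrableOn_Ioc]
    exact (hrint (0 - R) (0 + R)).1
  rw [ae_restrict_iff' measurableSet_Ioi]
  filter_upwards [LocallyIntegrable.ae_hasDerivAt_integral hloc] with t ht htm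
  have h1 : HasDerivAt F 0 t := by
    refine (hasDerivAt_const t (0 : ℝ)).congr_of_eventuallyEq ?_
    filter_upwards [Ioi_mem_nhds htm] with s hs
    exact hzero s (mem_Ioi.1 hs).le
  have h2 := (ht 0).unique h1
  rw [hr, indicator_of_mem htm] at h2
  exact (mul_eq_zero.1 h2).resolve_left (Real.exp_pos _).ne'

/-! ### Convolution on the half line -/

/-- The convolution `∫₀ᵗ f(τ) g(t - τ) dτ` of two functions on the half line. -/
def conv (f g : ℝ → ℝ) (t : ℝ) : ℝ := ∫ τ in (0 : ℝ)..t, f τ * g (t - τ)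

theorem conv_comm (f g : ℝ → ℝ) (t : ℝ) : conv f g t = conv g f t := by
  unfold conv
  have h := intervalIntegral.integral_comp_sub_left (a := 0) (b := t)
    (fun τ => g τ * f (t - τ)) t
  simp only [sub_sub_cancel, sub_self, sub_zero] at h
  rw [← h]
  simp only [mul_comm]

theorem ae_comp_sub_of_ae {P : ℝ → Prop} {t : ℝ}
    (h : ∀ᵐ τ ∂(volume.restrict (Ioo 0 t)), P τ) :
    ∀ᵐ τ ∂(volume.restrict (Ioo 0 t)), P (t - τ) := by
  rw [ae_restrict_iff' measurableSet_Ioo] at h ⊢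
  have h2 := (quasiMeasurePreserving_sub_left (volume : Measure ℝ) t).ae h
  filter_upwards [h2] with τ hτ hm
  exact hτ ⟨by linarith [hm.2], by linarith [hm.1]⟩

theorem conv_congr {f f' g g' : ℝ → ℝ} {t : ℝ} (ht : 0 ≤ t)
    (hf : ∀ᵐ τ ∂(volume.restrict (Ioo 0 t)), f τ = f' τ)
    (hg : ∀ᵐ τ ∂(volume.restrict (Ioo 0 t)), g τ = g' τ) : conv f g t = conv f' g' t := by
  unfold conv
  rw [intervalIntegral.integral_of_le ht, intervalIntegral.integral_of_le ht,
    integral_Ioc_eq_integral_Ioo, integral_Ioc_eq_integral_Ioo]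
  refine integral_congr_ae ?_
  filter_upwards [hf, ae_comp_sub_of_ae hg] with τ h1 h2
  rw [h1, h2]

theorem conv_congr_on {f f' g g' : ℝ → ℝ} {t : ℝ} (ht : 0 ≤ t)
    (hf : ∀ τ ∈ Ioo 0 t, f τ = f' τ) (hg : ∀ τ ∈ Ioo 0 t, g τ = g' τ) :
    conv f g t = conv f' g' t :=
  conv_congr ht ((ae_restrict_iff' measurableSet_Ioo).2 (ae_of_all _ hf))
    ((ae_restrict_iff' measurableSet_Ioo).2 (ae_of_all _ hg))

theorem convolution_eq_conv {u v : ℝ → ℝ} (hu : ∀ s ≤ 0, u s = 0) (hv : ∀ s ≤ 0, v s = 0)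
    {x : ℝ} (hx : 0 ≤ x) : convolution u v (ContinuousLinearMap.mul ℝ ℝ) volume x = conv u v x := by
  unfold conv convolution
  rw [intervalIntegral.integral_of_le hx]
  refine (setIntegral_eq_integral_of_forall_compl_eq_zero fun s hs => ?_).symm
  simp only [mem_Ioc, not_and_or, not_lt, not_le] at hs
  rcases hs with hs | hs
  · simp [hu s hs]
  · simp [hv (x - s) (by linarith)]

/-- Truncation of a function to `(0, T]`. -/
def trunc (T : ℝ) (f : ℝ → ℝ) : ℝ → ℝ := (Ioc 0 T).indicator f

theorem trunc_of_nonpos (T : ℝ) (f : ℝ → ℝ) {s : ℝ} (hs : s ≤ 0) : trunc T f s = 0 :=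
  indicator_of_notMem (fun h => absurd h.1 (not_lt.2 hs)) _

theorem trunc_of_mem {T : ℝ} (f : ℝ → ℝ) {s : ℝ} (h0 : 0 < s) (hT : s ≤ T) : trunc T f s = f s :=
  indicator_of_mem (show s ∈ Ioc 0 T from ⟨h0, hT⟩) f

theorem integrable_trunc {T : ℝ} {f : ℝ → ℝ} (hf : IntegrableOn f (Ioc 0 T)) :
    Integrable (trunc T f) := (integrable_indicator_iff measurableSet_Ioc).2 hf

theorem convolution_trunc {T x : ℝ} (f g : ℝ → ℝ) (hx : 0 ≤ x) (hxT : x ≤ T) :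
    convolution (trunc T f) (trunc T g) (ContinuousLinearMap.mul ℝ ℝ) volume x = conv f g x := by
  rw [convolution_eq_conv (fun s hs => trunc_of_nonpos T f hs) (fun s hs => trunc_of_nonpos T g hs)
    hx]
  exact conv_congr_on hx (fun τ hτ => trunc_of_mem f hτ.1 (by linarith [hτ.2]))
    (fun τ hτ => trunc_of_mem g hτ.1 (by linarith [hτ.2]))

theorem integrableOn_Ioc_conv {f g : ℝ → ℝ} {T : ℝ} (hf : IntegrableOn f (Ioc 0 T))
    (hg : IntegrableOn g (Ioc 0 T)) : IntegrableOn (conv f g) (Ioc 0 T) := by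
  have h := (integrable_trunc hf).integrable_convolution (ContinuousLinearMap.mul ℝ ℝ)
    (integrable_trunc hg)
  refine h.integrableOn.congr_fun (fun x hx => ?_) measurableSet_Ioc
  exact convolution_trunc f g hx.1.le hx.2

theorem integrableOn_Ioi_conv {f g : ℝ → ℝ} (hf : IntegrableOn f (Ioi 0))
    (hg : IntegrableOn g (Ioi 0)) : IntegrableOn (conv f g) (Ioi 0) := by
  have h := integrable_posConvolution hf hg (ContinuousLinearMap.mul ℝ ℝ)
  exact (integrable_indicator_iff measurableSet_Ioi).1 h

theorem intervalIntegrable_conv_integrand {f g : ℝ → ℝ} {t C : ℝ} (ht : 0 ≤ t)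
    (hf : IntegrableOn f (Ioc 0 t)) (hg : IntegrableOn g (Ioc 0 t))
    (hC : ∀ x ∈ Ioc 0 t, |f x| ≤ C) :
    IntervalIntegrable (fun τ => f τ * g (t - τ)) volume 0 t := by
  rw [intervalIntegrable_iff_integrableOn_Ioc_of_le ht]
  have h1 : IntegrableOn (fun τ => g (t - τ)) (Ioc 0 t) := by
    have h2 := ((intervalIntegrable_iff_integrableOn_Ioc_of_le ht).2 hg).comp_sub_left t
    simp only [sub_self, sub_zero] at h2
    exact (intervalIntegrable_iff_integrableOn_Ioc_of_le ht).1 h2.symm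
  refine Integrable.bdd_mul h1 hf.aestronglyMeasurable (c := C) ?_
  exact (ae_restrict_iff' measurableSet_Ioc).2 (ae_of_all _ hC)

/-- Associativity of the convolution when one of the factors is bounded. -/
theorem conv_assoc {f g h : ℝ → ℝ} {t C : ℝ} (ht : 0 ≤ t) (hf : IntegrableOn f (Ioc 0 t))
    (hg : IntegrableOn g (Ioc 0 t)) (hh : IntegrableOn h (Ioc 0 t))
    (hC : ∀ x ∈ Ioc 0 t, |f x| ≤ C) :
    conv (conv f g) h t = conv f (conv g h) t := by
  have hF := integrable_trunc hf
  have hG := integrable_trunc hg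
  have hH := integrable_trunc hh
  have hC0 : ∀ x, ‖trunc t f x‖ ≤ max C 0 := by
    intro x
    by_cases hx : x ∈ Ioc 0 t
    · rw [trunc, indicator_of_mem hx]
      exact (hC x hx).trans (le_max_left _ _)
    · rw [trunc, indicator_of_notMem hx, norm_zero]
      exact le_max_right _ _
  -- The boundedness of `f` serves to verify the integrability condition at the single point `t`;
  -- this yields equality at `t` and not only almost everywhere.
  have key := convolution_assoc (ContinuousLinearMap.mul ℝ ℝ) (ContinuousLinearMap.mul ℝ ℝ)
    (ContinuousLinearMap.mul ℝ ℝ) (ContinuousLinearMap.mul ℝ ℝ) (fun x y z => mul_assoc x y z)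
    (f := trunc t f) (g := trunc t g) (k := trunc t h) (x₀ := t) (ν := volume) (μ := volume)
    hF.aestronglyMeasurable hG.aestronglyMeasurable hH.aestronglyMeasurable
    (hF.ae_convolution_exists _ hG)
    (hG.norm.ae_convolution_exists _ hH.norm) (by
      have h1 := hG.norm.integrable_convolution (ContinuousLinearMap.mul ℝ ℝ) hH.norm
      refine Integrable.bdd_mul (c := max C 0) (h1.comp_sub_left t) hF.norm.aestronglyMeasurable
        (ae_of_all _ fun x => ?_)
      rw [norm_norm]; exact hC0 x)
  have hnn : ∀ {u v : ℝ → ℝ}, ∀ s ≤ 0, convolution (trunc t u) (trunc t v)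
      (ContinuousLinearMap.mul ℝ ℝ) volume s = 0 := by
    intro u v s hs
    unfold convolution
    refine integral_eq_zero_of_ae (ae_of_all _ fun x => ?_)
    rcases le_or_gt x 0 with hx | hx
    · simp [trunc_of_nonpos t u hx]
    · simp [trunc_of_nonpos t v (show s - x ≤ 0 by linarith)]
  rw [convolution_eq_conv hnn (fun s hs => trunc_of_nonpos t h hs) ht,
    convolution_eq_conv (fun s hs => trunc_of_nonpos t f hs) hnn ht] at key
  rw [conv_congr_on ht (fun τ hτ => (convolution_trunc f g hτ.1.le hτ.2.le).symm)
    (fun τ hτ => (trunc_of_mem h hτ.1 hτ.2.le).symm), key]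
  exact conv_congr_on ht (fun τ hτ => trunc_of_mem f hτ.1 hτ.2.le)
    (fun τ hτ => convolution_trunc g h hτ.1.le hτ.2.le)

theorem conv_one (f : ℝ → ℝ) (t : ℝ) : conv (fun _ => 1) f t = ∫ τ in (0 : ℝ)..t, f τ := by
  rw [conv_comm]; simp [conv]

/-- Convolving an integrable function with a bounded convergent one. -/
theorem tendsto_conv_atTop {p g : ℝ → ℝ} {L M : ℝ} (hp : IntegrableOn p (Ioi 0))
    (hgm : AEStronglyMeasurable g (volume.restrict (Ioi 0))) (hM : ∀ t, 0 < t → |g t| ≤ M)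
    (hg : Tendsto g atTop (𝓝 L)) :
    Tendsto (conv p g) atTop (𝓝 (L * ∫ t in Ioi (0 : ℝ), p t)) := by
  have hM0 : 0 ≤ M := (abs_nonneg _).trans (hM 1 one_pos)
  -- The indicator of `(0, t)` moves the dependence on `t` from the domain to the integrand, with
  -- dominating function `|p| M`.
  have h1 : Tendsto (fun t => ∫ τ in Ioi (0 : ℝ), (Ioo 0 t).indicator (fun τ => p τ * g (t - τ)) τ)
      atTop (𝓝 (∫ τ in Ioi (0 : ℝ), p τ * L)) := by
    refine tendsto_integral_filter_of_dominated_convergence (fun τ => |p τ| * M) ?_ ?_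
      (hp.norm.mul_const M) ?_
    · filter_upwards [eventually_gt_atTop 0] with t ht
      rw [aestronglyMeasurable_indicator_iff measurableSet_Ioo,
        Measure.restrict_restrict measurableSet_Ioo]
      have hsub : Ioo 0 t ∩ Ioi 0 = Ioo 0 t := inter_eq_left.2 Ioo_subset_Ioi_self
      rw [hsub]
      refine (hp.aestronglyMeasurable.mono_set Ioo_subset_Ioi_self).mul ?_
      have hq := (Measure.measurePreserving_sub_left (volume : Measure ℝ) t).restrict_preimage
        (s := Ioo 0 t) measurableSet_Ioo
      have hpre : (fun x => t - x) ⁻¹' Ioo 0 t = Ioo 0 t := by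
        ext x; simp only [mem_preimage, mem_Ioo]; constructor <;> intro h <;> constructor <;> linarith [h.1, h.2]
      rw [hpre] at hq
      exact (hgm.mono_set Ioo_subset_Ioi_self).comp_measurePreserving hq
    · refine Eventually.of_forall fun t => ae_of_all _ fun τ => ?_
      by_cases h : τ ∈ Ioo 0 t
      · rw [indicator_of_mem h, norm_mul]
        exact mul_le_mul_of_nonneg_left (hM _ (by linarith [h.2])) (norm_nonneg _)
      · rw [indicator_of_notMem h, norm_zero]; positivity
    · refine (ae_restrict_iff' measurableSet_Ioi).2 (ae_of_all _ fun τ hτ => ?_)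
      have h2 : Tendsto (fun t => t - τ) atTop atTop := tendsto_atTop_add_const_right _ (-τ) tendsto_id
      refine ((hg.comp h2).const_mul (p τ)).congr' ?_
      filter_upwards [eventually_gt_atTop τ] with t ht
      rw [indicator_of_mem (show τ ∈ Ioo 0 t from ⟨hτ, ht⟩)]
      rfl
  rw [integral_mul_const, mul_comm] at h1
  refine h1.congr' ?_
  filter_upwards [eventually_gt_atTop 0] with t ht
  rw [setIntegral_indicator measurableSet_Ioo, inter_eq_right.2 Ioo_subset_Ioi_self, conv,
    intervalIntegral.integral_of_le ht.le, integral_Ioc_eq_integral_Ioo]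

/-! ### The inverse Laplace transform of the transfer function -/

/-- The inverse Laplace transform of the transfer function `P a · 1`, obtained by subordination
from the fundamental solution of the delay equation. -/
def transferKernel (a t : ℝ) : ℝ :=
  1 / 2 * ∫ x in Ioi (0 : ℝ), delaySol a x * passageDensity (x + 1) t

section TransferKernel

variable {a : ℝ}

theorem measurable_passageDensity_uncurry :
    Measurable fun q : ℝ × ℝ => passageDensity (q.1 + 1) q.2 := by
  unfold passageDensity heatKernel
  fun_prop

theorem transferKernel_nonneg (ha : 0 < a) (hae : a ≤ Real.exp (-1)) {t : ℝ} (ht : 0 ≤ t) :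
    0 ≤ transferKernel a t := by
  refine mul_nonneg (by norm_num) (setIntegral_nonneg measurableSet_Ioi fun x hx => ?_)
  have hx0 : 0 < x := hx
  exact mul_nonneg (delaySol_nonneg ha hae x) (passageDensity_nonneg (by linarith) ht)

/-- Integrating first in time, each passage density has mass `1` and the integral of `Y` remains. -/
theorem integrable_delaySol_mul_passageDensity (ha : 0 < a) (hae : a ≤ Real.exp (-1)) :
    Integrable (fun q : ℝ × ℝ => delaySol a q.1 * passageDensity (q.1 + 1) q.2)
      ((volume.restrict (Ioi 0)).prod (volume.restrict (Ioi 0))) := by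
  have hmeas : AEStronglyMeasurable
      (fun q : ℝ × ℝ => delaySol a q.1 * passageDensity (q.1 + 1) q.2)
      ((volume.restrict (Ioi 0)).prod (volume.restrict (Ioi 0))) :=
    (((continuous_delaySol a).measurable.comp measurable_fst).mul
      measurable_passageDensity_uncurry).aestronglyMeasurable
  rw [integrable_prod_iff hmeas]
  constructor
  · refine (ae_restrict_iff' measurableSet_Ioi).2 (ae_of_all _ fun x hx => ?_)
    have hx0 : 0 < x := hx
    exact (integral_passageDensity (y := x + 1) (by linarith)).1.const_mul (delaySol a x)
  · refine (integrableOn_delaySol ha hae).congr_fun (fun x hx => ?_) measurableSet_Ioi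
    have hx0 : 0 < x := hx
    have h1 : ∫ t in Ioi (0 : ℝ), ‖delaySol a x * passageDensity (x + 1) t‖ =
        ∫ t in Ioi (0 : ℝ), delaySol a x * passageDensity (x + 1) t := by
      refine setIntegral_congr_fun measurableSet_Ioi fun t ht => Real.norm_of_nonneg ?_
      exact mul_nonneg (delaySol_nonneg ha hae x)
        (passageDensity_nonneg (by linarith) (mem_Ioi.1 ht).le)
    simp only [h1]
    rw [integral_const_mul, (integral_passageDensity (by linarith)).2, mul_one]

theorem integrableOn_transferKernel (ha : 0 < a) (hae : a ≤ Real.exp (-1)) :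
    IntegrableOn (transferKernel a) (Ioi 0) :=
  (integrable_delaySol_mul_passageDensity ha hae).integral_prod_right.const_mul _

theorem integrableOn_exp_mul {f : ℝ → ℝ} (hf : IntegrableOn f (Ioi 0)) {s : ℝ} (hs : 0 ≤ s) :
    IntegrableOn (fun t => f t * Real.exp (-(s * t))) (Ioi 0) := by
  refine Integrable.mul_bdd (c := 1) hf (Continuous.aestronglyMeasurable (by fun_prop)) ?_
  refine (ae_restrict_iff' measurableSet_Ioi).2 (ae_of_all _ fun t ht => ?_)
  rw [Real.norm_of_nonneg (Real.exp_pos _).le, Real.exp_le_one_iff]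
  have := mul_nonneg hs (mem_Ioi.1 ht).le
  linarith

/-- Subordination: after exchanging the integrals, the passage density at distance `x + 1`
contributes `exp(-(x+1)w)`, leaving `½ exp(-w)` times the transform of `Y` at `w`. -/
theorem laplace_transferKernel (ha : 0 < a) (hae : a ≤ Real.exp (-1)) {w : ℝ} (hw : 0 < w) :
    ∫ t in Ioi (0 : ℝ), transferKernel a t * Real.exp (-(w ^ 2 * t)) =
      Real.exp (-w) / (2 * (w + a * Real.exp (-w))) := by
  have hint := integrable_delaySol_mul_passageDensity ha hae
  have hint2 : Integrable (fun q : ℝ × ℝ => delaySol a q.1 * passageDensity (q.1 + 1) q.2 *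
      Real.exp (-(w ^ 2 * q.2))) ((volume.restrict (Ioi 0)).prod (volume.restrict (Ioi 0))) := by
    refine Integrable.mul_bdd (c := 1) hint (Continuous.aestronglyMeasurable (by fun_prop)) ?_
    rw [Measure.prod_restrict]
    refine (ae_restrict_iff' (measurableSet_Ioi.prod measurableSet_Ioi)).2
      (ae_of_all _ fun q hq => ?_)
    rw [Real.norm_of_nonneg (Real.exp_pos _).le, Real.exp_le_one_iff]
    have := mul_nonneg (sq_nonneg w) (mem_Ioi.1 hq.2).le
    linarith
  have hswap := integral_integral_swap (μ := volume.restrict (Ioi (0 : ℝ)))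
    (ν := volume.restrict (Ioi (0 : ℝ)))
    (f := fun x t => delaySol a x * passageDensity (x + 1) t * Real.exp (-(w ^ 2 * t))) hint2
  have h1 : ∫ t in Ioi (0 : ℝ), transferKernel a t * Real.exp (-(w ^ 2 * t)) =
      1 / 2 * ∫ t in Ioi (0 : ℝ), ∫ x in Ioi (0 : ℝ),
        delaySol a x * passageDensity (x + 1) t * Real.exp (-(w ^ 2 * t)) := by
    rw [← integral_const_mul]
    refine integral_congr_ae (ae_of_all _ fun t => ?_)
    simp only [transferKernel]
    rw [integral_mul_const]; ring
  rw [h1, ← hswap]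
  have h2 : ∀ x ∈ Ioi (0 : ℝ), ∫ t in Ioi (0 : ℝ),
      delaySol a x * passageDensity (x + 1) t * Real.exp (-(w ^ 2 * t)) =
        Real.exp (-w) * (delaySol a x * Real.exp (-(x * w))) := by
    intro x hx
    have hx0 : 0 < x := hx
    simp only [mul_assoc]
    rw [integral_const_mul, (laplace_passageDensity (by linarith) hw).2, mul_left_comm,
      ← Real.exp_add]
    ring_nf
  rw [setIntegral_congr_fun measurableSet_Ioi h2, integral_const_mul,
    (laplace_delaySol ha hae hw).2]
  have : 0 < w + a * Real.exp (-w) := by positivity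
  field_simp

/-- The Laplace transform of the transfer kernel, on the right half-plane. -/
def transferLaplace (a : ℝ) (s : ℂ) : ℂ :=
  ∫ t in Ioi (0 : ℝ), Complex.exp (-s * t) * (transferKernel a t : ℂ)

theorem transferLaplace_ofReal (ha : 0 < a) (hae : a ≤ Real.exp (-1)) {s : ℝ} (hs : 0 < s) :
    transferLaplace a s = ((Real.exp (-√s) / (2 * (√s + a * Real.exp (-√s))) : ℝ) : ℂ) := by
  rw [← laplace_transferKernel ha hae (Real.sqrt_pos.2 hs), ← integral_complex_ofReal,
    transferLaplace]
  congr 1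
  ext t
  rw [Real.sq_sqrt hs.le]
  push_cast
  rw [mul_comm, neg_mul]

/-- Because the kernel is nonnegative and integrable, it is the density of a finite measure on `(0,
∞)`, and its transform is the complex moment generating function of `t ↦ -t`, analytic wherever the
real exponential moments exist. -/
theorem analyticOnNhd_transferLaplace (ha : 0 < a) (hae : a ≤ Real.exp (-1)) :
    AnalyticOnNhd ℂ (transferLaplace a) {s | 0 < s.re} := by
  set μ : Measure ℝ := (volume.restrict (Ioi (0 : ℝ))).withDensity
    fun t => ENNReal.ofReal (transferKernel a t) with hμ
  have hpi := integrableOn_transferKernel ha hae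
  have hfin : IsFiniteMeasure μ := isFiniteMeasure_withDensity_ofReal hpi.2
  have hsupp : ∀ᵐ t ∂μ, 0 < t :=
    (withDensity_absolutelyContinuous _ _).ae_le (ae_restrict_mem measurableSet_Ioi)
  have heq : transferLaplace a = ProbabilityTheory.complexMGF (fun t : ℝ => -t) μ := by
    ext s
    rw [ProbabilityTheory.complexMGF, hμ, integral_withDensity_eq_integral_toReal_smul₀
      (hpi.aestronglyMeasurable.aemeasurable.ennreal_ofReal) (ae_of_all _ fun _ => ENNReal.ofReal_lt_top)]
    refine setIntegral_congr_fun measurableSet_Ioi fun t ht => ?_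
    rw [ENNReal.toReal_ofReal (transferKernel_nonneg ha hae (mem_Ioi.1 ht).le)]
    push_cast
    rw [Complex.real_smul, mul_comm]
    ring_nf
  have hset : Ioi (0 : ℝ) ⊆ ProbabilityTheory.integrableExpSet (fun t : ℝ => -t) μ := by
    intro s hs
    refine Integrable.mono' (integrable_const (1 : ℝ))
      (Continuous.aestronglyMeasurable (by fun_prop)) ?_
    filter_upwards [hsupp] with t ht
    rw [Real.norm_of_nonneg (Real.exp_pos _).le, Real.exp_le_one_iff]
    have := mul_pos (mem_Ioi.1 hs) ht
    linarith
  rw [heq]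
  refine ProbabilityTheory.analyticOnNhd_complexMGF.mono fun s hs => ?_
  exact (interior_maximal hset isOpen_Ioi) hs

theorem analyticOnNhd_Q_one : AnalyticOnNhd ℂ (fun s => Q s 1) {s | 0 < s.re} := by
  refine DifferentiableOn.analyticOnNhd ?_ (isOpen_lt continuous_const Complex.continuous_re)
  intro s hs
  have hs' : s ∈ Complex.slitPlane := Or.inl hs
  have hs0 : s ≠ 0 := Complex.slitPlane_ne_zero hs'
  have h1 : DifferentiableAt ℂ (fun s : ℂ => s ^ (1 / 2 : ℂ)) s :=
    differentiableAt_id.cpow_const hs'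
  refine DifferentiableAt.differentiableWithinAt ?_
  unfold Q
  refine DifferentiableAt.div (h1.const_mul _).cexp (h1.const_mul _) ?_
  refine mul_ne_zero two_ne_zero ?_
  rw [Ne, Complex.cpow_eq_zero_iff]
  tauto

theorem Q_one_ne_zero {s : ℂ} (hs : 0 < s.re) : Q s 1 ≠ 0 := by
  have hs0 : s ≠ 0 := Complex.slitPlane_ne_zero (Or.inl hs)
  refine div_ne_zero (Complex.exp_ne_zero _) (mul_ne_zero two_ne_zero ?_)
  rw [Ne, Complex.cpow_eq_zero_iff]
  tauto

theorem Q_one_ofReal {s : ℝ} (hs : 0 < s) :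
    Q s 1 = ((Real.exp (-√s) / (2 * √s) : ℝ) : ℂ) := by
  have h : (s : ℂ) ^ (1 / 2 : ℂ) = (√s : ℝ) := by
    rw [Real.sqrt_eq_rpow, Complex.ofReal_cpow hs.le]
    norm_num
  rw [Q, h]
  push_cast
  ring_nf

/-- The identity is continued from the positive reals in the multiplied form `p̂ (1 + 2aQ) = Q`.
This avoids knowing beforehand that the denominator has no zero; a zero would force `Q = 0`, which
is impossible, so nonvanishing comes out as a by-product. -/
theorem transferLaplace_eq_P (ha : 0 < a) (hae : a ≤ Real.exp (-1)) {s : ℂ} (hs : 0 < s.re) :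
    transferLaplace a s = P a s 1 := by
  have hpre : IsPreconnected {s : ℂ | 0 < s.re} :=
    (convex_halfSpace_re_gt 0).isPreconnected
  have hA := analyticOnNhd_transferLaplace ha hae
  have hQ := analyticOnNhd_Q_one
  have hL : AnalyticOnNhd ℂ (fun s => transferLaplace a s * (1 + 2 * a * Q s 1))
      {s | 0 < s.re} :=
    hA.mul (analyticOnNhd_const.add (analyticOnNhd_const.mul hQ))
  have hreal : ∀ r : ℝ, 0 < r → transferLaplace a r * (1 + 2 * a * Q r 1) = Q r 1 := by
    intro r hr
    rw [transferLaplace_ofReal ha hae hr, Q_one_ofReal hr]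
    norm_cast
    have hw := Real.sqrt_pos.2 hr
    have h1 : 0 < √r + a * Real.exp (-√r) := by positivity
    field_simp
  have hfreq : ∃ᶠ z in 𝓝[≠] (1 : ℂ), transferLaplace a z * (1 + 2 * a * Q z 1) = Q z 1 := by
    have ht : Tendsto (fun r : ℝ => (r : ℂ)) (𝓝[≠] 1) (𝓝[≠] 1) := by
      refine tendsto_nhdsWithin_iff.2 ⟨?_, ?_⟩
      · exact (Complex.continuous_ofReal.tendsto' 1 1 (by simp)).mono_left nhdsWithin_le_nhds
      · filter_upwards [self_mem_nhdsWithin] with r hr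
        simpa using hr
    refine ht.frequently (Eventually.frequently ?_)
    filter_upwards [nhdsWithin_le_nhds (Ioi_mem_nhds (zero_lt_one (α := ℝ)))] with r hr
    exact hreal r hr
  have hEq := hL.eqOn_of_preconnected_of_frequently_eq hQ hpre (z₀ := 1) (by simp) hfreq hs
  simp only at hEq
  have hne : 1 + 2 * a * Q s 1 ≠ 0 := by
    intro h0
    rw [h0, mul_zero] at hEq
    exact Q_one_ne_zero hs hEq.symm
  rw [P, eq_div_iff hne, hEq]

theorem isInverseLaplace_transferKernel (ha : 0 < a) (hae : a ≤ Real.exp (-1)) :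
    IsInverseLaplace (transferKernel a) fun s => P a s 1 := by
  have hpi := integrableOn_transferKernel ha hae
  refine ⟨fun T => ?_, 0, fun s hs => ?_⟩
  · rw [memLp_one_iff_integrable]
    change IntegrableOn _ _ _
    rw [integrableOn_Icc_iff_integrableOn_Ioc]
    exact hpi.mono_set Ioc_subset_Ioi_self
  · simp only
    rw [← transferLaplace_eq_P ha hae hs]
    refine intervalIntegral_tendsto_integral_Ioi 0 ?_ tendsto_id
    refine Integrable.bdd_mul (c := 1) hpi.ofReal (Continuous.aestronglyMeasurable (by fun_prop)) ?_
    refine (ae_restrict_iff' measurableSet_Ioi).2 (ae_of_all _ fun t ht => ?_)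
    rw [Complex.norm_exp, Real.exp_le_one_iff]
    have := mul_pos hs (mem_Ioi.1 ht)
    simp
    linarith

/-- Two inverse Laplace transforms of the same function agree almost everywhere. -/
theorem IsInverseLaplace.ae_eq {p q : ℝ → ℝ} {F : ℂ → ℂ} (hp : IsInverseLaplace p F)
    (hq : IsInverseLaplace q F) : p =ᵐ[volume.restrict (Ioi 0)] q := by
  obtain ⟨hpl, σ, hpσ⟩ := hp
  obtain ⟨hql, τ, hqτ⟩ := hq
  have hpi : ∀ T, IntegrableOn p (Icc 0 T) := fun T => memLp_one_iff_integrable.1 (hpl T)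
  have hqi : ∀ T, IntegrableOn q (Icc 0 T) := fun T => memLp_one_iff_integrable.1 (hql T)
  have h := ae_eq_zero_of_laplace_eq_zero (q := fun t => p t - q t) (σ := max σ τ)
    (fun T => ((hpi T).sub (hqi T)).mono_set Ioc_subset_Icc_self) (fun s hs => ?_)
  · filter_upwards [h] with t ht
    linarith
  · have h1 := hpσ s (by simpa using (le_max_left _ _).trans_lt hs)
    have h2 := hqτ s (by simpa using (le_max_right _ _).trans_lt hs)
    have h3 := (Complex.continuous_re.tendsto _).comp (h1.sub h2)
    rw [sub_self, Complex.zero_re] at h3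
    refine h3.congr' ?_
    filter_upwards [eventually_ge_atTop 0] with T hT
    have e1 : ∀ f : ℝ → ℝ, ∫ t in (0 : ℝ)..T, Complex.exp (-s * t) * (f t : ℂ) =
        ((∫ t in (0 : ℝ)..T, Real.exp (-(s * t)) * f t : ℝ) : ℂ) := by
      intro f
      rw [← intervalIntegral.integral_ofReal]
      congr 1; ext t; push_cast; ring_nf
    have e2 : ∀ f : ℝ → ℝ, IntegrableOn f (Icc 0 T) →
        IntervalIntegrable (fun t => Real.exp (-(s * t)) * f t) volume 0 T := by
      intro f hf
      rw [intervalIntegrable_iff_integrableOn_Icc_of_le hT]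
      exact hf.continuousOn_mul (by fun_prop) isCompact_Icc
    simp only [Function.comp]
    rw [e1, e1, ← Complex.ofReal_sub, Complex.ofReal_re, ← intervalIntegral.integral_sub
      (e2 p (hpi T)) (e2 q (hqi T))]
    simp only [mul_sub]

/-- The resolvent equation satisfied by the transfer kernel. -/
theorem transferKernel_resolvent (ha : 0 < a) (hae : a ≤ Real.exp (-1)) :
    ∀ᵐ t ∂(volume.restrict (Ioi 0)), transferKernel a t +
      2 * a * conv (fun s => heatKernel s 1) (transferKernel a) t = heatKernel t 1 := by
  have hpi := integrableOn_transferKernel ha hae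
  have key : ∀ s : ℝ, 0 < s →
      IntegrableOn (fun t => Real.exp (-(s * t)) * (transferKernel a t + 2 * a *
        conv (fun s => heatKernel s 1) (transferKernel a) t - heatKernel t 1)) (Ioi 0) ∧
      ∫ t in Ioi (0 : ℝ), Real.exp (-(s * t)) * (transferKernel a t + 2 * a *
        conv (fun s => heatKernel s 1) (transferKernel a) t - heatKernel t 1) = 0 := by
    intro s hs
    have hw := Real.sqrt_pos.2 hs
    have hp := integrableOn_exp_mul hpi hs.le
    have hpL := laplace_transferKernel ha hae hw
    have hk := laplace_heatKernel one_pos hw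
    simp only [Real.sq_sqrt hs.le, one_mul] at hpL hk
    have hc := (integrable_posConvolution hk.1 hp (ContinuousLinearMap.mul ℝ ℝ))
    have hcL := integral_posConvolution hk.1 hp (ContinuousLinearMap.mul ℝ ℝ)
    have hconv : ∀ x : ℝ, ∫ t in (0 : ℝ)..x, (ContinuousLinearMap.mul ℝ ℝ)
        (heatKernel t 1 * Real.exp (-(s * t)))
        (transferKernel a (x - t) * Real.exp (-(s * (x - t)))) =
        Real.exp (-(s * x)) * conv (fun s => heatKernel s 1) (transferKernel a) x := by
      intro x
      rw [conv, ← intervalIntegral.integral_const_mul]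
      congr 1; ext t
      rw [ContinuousLinearMap.mul_apply', show -(s * x) = -(s * t) + -(s * (x - t)) by ring,
        Real.exp_add]
      ring
    have hc2 : IntegrableOn (fun x => Real.exp (-(s * x)) *
        conv (fun s => heatKernel s 1) (transferKernel a) x) (Ioi 0) := by
      have := (integrable_indicator_iff measurableSet_Ioi).1 hc
      simpa only [hconv] using this
    simp only [hconv] at hcL
    have e : (fun t => Real.exp (-(s * t)) * (transferKernel a t + 2 * a *
        conv (fun s => heatKernel s 1) (transferKernel a) t - heatKernel t 1)) =
        fun t => transferKernel a t * Real.exp (-(s * t)) + 2 * a * (Real.exp (-(s * t)) *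
        conv (fun s => heatKernel s 1) (transferKernel a) t) -
        heatKernel t 1 * Real.exp (-(s * t)) := by
      ext t; ring
    rw [e]
    have hpc : IntegrableOn (fun t => transferKernel a t * Real.exp (-(s * t)) +
        2 * a * (Real.exp (-(s * t)) * conv (fun s => heatKernel s 1) (transferKernel a) t))
        (Ioi 0) := hp.add (hc2.const_mul _)
    refine ⟨hpc.sub hk.1, ?_⟩
    rw [integral_sub hpc hk.1, integral_add hp (hc2.const_mul _),
      integral_const_mul, hcL, hpL, hk.2, ContinuousLinearMap.mul_apply']
    have h1 : 0 < √s + a * Real.exp (-√s) := by positivity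
    field_simp
    ring
  have h := ae_eq_zero_of_laplace_eq_zero (q := fun t => transferKernel a t + 2 * a *
        conv (fun s => heatKernel s 1) (transferKernel a) t - heatKernel t 1) (σ := 0)
    (fun T => ?_) (fun s hs => ?_)
  · filter_upwards [h] with t ht
    linarith
  · have h1 := (key 1 one_pos).1.mono_set (Ioc_subset_Ioi_self (a := T) (b := 0))
    rw [← integrableOn_Icc_iff_integrableOn_Ioc] at h1
    have h2 := h1.continuousOn_mul (g := fun t => Real.exp t) (by fun_prop) isCompact_Icc
    refine (h2.mono_set Ioc_subset_Icc_self).congr_fun (fun t _ => ?_) measurableSet_Ioc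
    simp only
    rw [← mul_assoc, ← Real.exp_add]
    simp
  · have h1 := intervalIntegral_tendsto_integral_Ioi 0 (key s hs).1 tendsto_id
    rw [(key s hs).2] at h1
    exact h1

end TransferKernel

/-! ### Gaussian bounds for the heat kernel -/

/-- The wider Gaussian used to dominate the heat kernel and its derivatives. -/
def wideGauss (t z : ℝ) : ℝ := Real.exp (-(z ^ 2 / (8 * t)))

theorem wideGauss_pos (t z : ℝ) : 0 < wideGauss t z := Real.exp_pos _

/-- Halving the exponent leaves one Gaussian factor to absorb polynomial weights and another to be
measured in `L²`. -/
theorem heatKernel_eq_wideGauss_sq {t : ℝ} (z : ℝ) :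
    heatKernel t z = wideGauss t z * wideGauss t z / √(4 * Real.pi * t) := by
  rw [heatKernel, wideGauss, ← Real.exp_add]
  congr 2
  ring

theorem three_mul_sqrt_le {t : ℝ} (ht : 0 < t) : 3 * √t ≤ √(4 * Real.pi * t) := by
  apply Real.le_sqrt_of_sq_le
  rw [mul_pow, Real.sq_sqrt ht.le]
  nlinarith [Real.pi_gt_three]

/-- The heat kernel times a factor controlled by the Gaussian exponent is dominated by the wide
Gaussian. -/
theorem heatKernel_mul_le {t : ℝ} (ht : 0 < t) {z m B : ℝ} (hB : 0 ≤ B)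
    (hm : |m| ≤ B * (1 + z ^ 2 / (8 * t))) :
    |heatKernel t z * m| ≤ B / (3 * √t) * wideGauss t z := by
  have hs := Real.sqrt_pos.2 ht
  have h3 := three_mul_sqrt_le ht
  have hw := wideGauss_pos t z
  have hexp : |m| * wideGauss t z ≤ B := by
    have h1 : 1 + z ^ 2 / (8 * t) ≤ Real.exp (z ^ 2 / (8 * t)) := by
      linarith [Real.add_one_le_exp (z ^ 2 / (8 * t))]
    calc |m| * wideGauss t z ≤ (B * Real.exp (z ^ 2 / (8 * t))) * wideGauss t z := by
          gcongr; exact hm.trans (by gcongr)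
      _ = B := by rw [wideGauss, mul_assoc, ← Real.exp_add]; simp
  rw [abs_mul, abs_of_nonneg (heatKernel_nonneg t z), heatKernel_eq_wideGauss_sq]
  calc wideGauss t z * wideGauss t z / √(4 * Real.pi * t) * |m|
      = (|m| * wideGauss t z) / √(4 * Real.pi * t) * wideGauss t z := by ring
    _ ≤ B / (3 * √t) * wideGauss t z := by gcongr

theorem heatKernel_le_wideGauss {t : ℝ} (ht : 0 < t) (z : ℝ) :
    |heatKernel t z| ≤ t ^ (-1 / 2 : ℝ) * wideGauss t z := by
  have h := heatKernel_mul_le ht (z := z) (m := 1) (B := 1) zero_le_one (by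
    rw [abs_one]; have : 0 ≤ z ^ 2 / (8 * t) := by positivity
    linarith)
  rw [mul_one] at h
  refine h.trans ?_
  have h0 := (wideGauss_pos t z).le
  gcongr
  rw [show (-1 / 2 : ℝ) = -(1 / 2) by norm_num, Real.rpow_neg ht.le, ← Real.sqrt_eq_rpow,
    ← one_div]
  have hs := Real.sqrt_pos.2 ht
  gcongr
  linarith

theorem heatKernel_space_deriv_le {t : ℝ} (ht : 0 < t) (z : ℝ) :
    |heatKernel t z * (-(z / (2 * t)))| ≤ t ^ (-1 : ℝ) * wideGauss t z := by
  have hs := Real.sqrt_pos.2 ht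
  have hsq := Real.mul_self_sqrt ht.le
  have h := heatKernel_mul_le ht (z := z) (m := -(z / (2 * t))) (B := 1 / √t) (by positivity) (by
    rw [abs_neg, abs_div, abs_of_pos (show 0 < 2 * t by linarith), div_le_iff₀ (by linarith)]
    have e : 1 / √t * (1 + z ^ 2 / (8 * t)) * (2 * t) = 2 * √t + z ^ 2 / (4 * √t) := by
      field_simp
      rw [Real.sq_sqrt ht.le]; ring
    rw [e, ← sub_nonneg]
    have e2 : 2 * √t + z ^ 2 / (4 * √t) - |z| = ((|z| - 2 * √t) ^ 2 + 4 * t) / (4 * √t) := by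
      rw [← sq_abs z]
      field_simp
      nlinarith
    rw [e2]; positivity)
  refine h.trans ?_
  have h0 := (wideGauss_pos t z).le
  gcongr
  rw [Real.rpow_neg_one, ← one_div, div_div]
  gcongr
  nlinarith

theorem heatKernel_time_deriv_le {t : ℝ} (ht : 0 < t) (z : ℝ) :
    |heatKernel t z * (z ^ 2 / (4 * t ^ 2) - 1 / (2 * t))| ≤
      t ^ (-3 / 2 : ℝ) * wideGauss t z := by
  have hs := Real.sqrt_pos.2 ht
  have h := heatKernel_mul_le ht (z := z) (m := z ^ 2 / (4 * t ^ 2) - 1 / (2 * t)) (B := 2 / t)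
    (by positivity) (by
    have e : 2 / t * (1 + z ^ 2 / (8 * t)) = z ^ 2 / (4 * t ^ 2) + 2 / t := by
      field_simp; ring
    have e2 : 1 / (2 * t) ≤ 2 / t := by
      rw [div_le_div_iff₀ (by positivity) ht]; linarith
    have e3 : 0 ≤ z ^ 2 / (4 * t ^ 2) := by positivity
    have e4 : 0 ≤ 1 / (2 * t) := by positivity
    rw [e, abs_le]
    constructor <;> linarith)
  refine h.trans ?_
  have h0 := (wideGauss_pos t z).le
  gcongr
  rw [show (-3 / 2 : ℝ) = -1 + -(1 / 2) by norm_num, Real.rpow_add ht, Real.rpow_neg_one,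
    Real.rpow_neg ht.le, ← Real.sqrt_eq_rpow, ← mul_inv, ← one_div, div_div,
    div_le_div_iff₀ (by positivity) (by positivity)]
  have : 0 < t * √t := by positivity
  linarith

/-- Away from the origin `1 ≤ z² ≤ 8t (1 + z²/(8t))`, so `B = 8t` is admissible and a whole power of
`t` is gained. -/
theorem heatKernel_le_of_one_le_abs {t z : ℝ} (ht : 0 < t) (hz : 1 ≤ |z|) :
    |heatKernel t z| ≤ 8 * t ^ (1 / 2 : ℝ) * wideGauss t z := by
  have hs := Real.sqrt_pos.2 ht
  have hz2 : 1 ≤ z ^ 2 := by rw [← sq_abs]; nlinarith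
  have h := heatKernel_mul_le ht (z := z) (m := 1) (B := 8 * t) (by positivity) (by
    rw [abs_one]
    have e : 8 * t * (1 + z ^ 2 / (8 * t)) = 8 * t + z ^ 2 := by field_simp
    rw [e]; linarith)
  rw [mul_one] at h
  refine h.trans ?_
  have h0 := (wideGauss_pos t z).le
  gcongr
  rw [← Real.sqrt_eq_rpow, div_le_iff₀ (by positivity)]
  nlinarith [Real.mul_self_sqrt ht.le]

/-! ### Square integrable functions -/

/-- The norm of `L²(ℝ)` as a real number. -/
def l2norm (f : ℝ → ℝ) : ℝ := (eLpNorm f 2 volume).toReal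

theorem l2norm_nonneg (f : ℝ → ℝ) : 0 ≤ l2norm f := ENNReal.toReal_nonneg

theorem abs_integral_mul_le_l2norm {φ f : ℝ → ℝ} (hφ : MemLp φ 2 volume) (hf : MemLp f 2 volume) :
    Integrable (fun y => φ y * f y) ∧ |∫ y, φ y * f y| ≤ l2norm φ * l2norm f := by
  have h1 : MemLp (fun y => φ y * f y) 1 volume := hf.mul hφ
  have h2 := memLp_one_iff_integrable.1 h1
  refine ⟨h2, ?_⟩
  have h3 := eLpNorm_smul_le_mul_eLpNorm (p := 2) (q := 2) (r := 1) (μ := volume)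
    hf.aestronglyMeasurable hφ.aestronglyMeasurable
  rw [l2norm, l2norm, ← ENNReal.toReal_mul]
  refine le_trans ?_ (ENNReal.toReal_mono (ENNReal.mul_ne_top hφ.2.ne hf.2.ne) h3)
  rw [← Real.norm_eq_abs]
  refine (norm_integral_le_integral_norm _).trans (le_of_eq ?_)
  rw [integral_norm_eq_lintegral_enorm h2.1, eLpNorm_one_eq_lintegral_enorm]
  rfl

theorem memLp_wideGauss {t : ℝ} (ht : 0 < t) (x : ℝ) :
    MemLp (fun y => wideGauss t (x - y)) 2 volume ∧
      l2norm (fun y => wideGauss t (x - y)) ≤ 2 * t ^ (1 / 4 : ℝ) := by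
  have hcont : Continuous fun y => wideGauss t (x - y) := by unfold wideGauss; fun_prop
  have hb : 0 < 1 / (4 * t) := by positivity
  have hsq : ∀ y, wideGauss t (x - y) ^ 2 = Real.exp (-(1 / (4 * t)) * (x - y) ^ 2) := by
    intro y
    rw [wideGauss, ← Real.exp_nat_mul]
    congr 1
    push_cast
    field_simp; ring
  have hm : MemLp (fun y => wideGauss t (x - y)) 2 volume := by
    rw [memLp_two_iff_integrable_sq hcont.aestronglyMeasurable]
    simp only [hsq]
    exact (integrable_exp_neg_mul_sq hb).comp_sub_left x
  refine ⟨hm, ?_⟩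
  rw [l2norm, hm.eLpNorm_eq_integral_rpow_norm two_ne_zero ENNReal.ofNat_ne_top,
    ENNReal.toReal_ofReal (by positivity)]
  have h1 : ∫ y, ‖wideGauss t (x - y)‖ ^ (2 : ℝ≥0∞).toReal = √(4 * Real.pi * t) := by
    simp only [ENNReal.toReal_ofNat, Real.rpow_two, Real.norm_eq_abs, sq_abs, hsq]
    rw [integral_sub_left_eq_self (fun y => Real.exp (-(1 / (4 * t)) * y ^ 2)), integral_gaussian]
    congr 1; field_simp
  -- This square root is the squared `L²` norm; `π ≤ 4` produces the constant `2` after taking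
  -- another root.
  have h2 : √(4 * Real.pi * t) ≤ 4 * √t := by
    rw [Real.sqrt_le_left (by positivity), mul_pow, Real.sq_sqrt ht.le]
    nlinarith [Real.pi_le_four]
  rw [h1]
  calc √(4 * Real.pi * t) ^ ((2 : ℝ≥0∞).toReal⁻¹) ≤ (4 * √t) ^ ((2 : ℝ≥0∞).toReal⁻¹) := by gcongr
    _ = 2 * t ^ (1 / 4 : ℝ) := by
      rw [Real.mul_rpow (by norm_num) (Real.sqrt_nonneg t), Real.sqrt_eq_rpow, ← Real.rpow_mul ht.le,
        show (4 : ℝ) = 2 ^ (2 : ℝ) by norm_num, ← Real.rpow_mul (by norm_num)]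
      norm_num

/-- Cauchy-Schwarz for functions dominated by a wide Gaussian. -/
theorem gauss_mul_integral_le {t x A : ℝ} (ht : 0 < t) (hA : 0 ≤ A) {φ f : ℝ → ℝ}
    (hφm : AEStronglyMeasurable φ volume) (hφ : ∀ y, |φ y| ≤ A * wideGauss t (x - y))
    (hf : MemLp f 2 volume) :
    Integrable (fun y => φ y * f y) ∧ |∫ y, φ y * f y| ≤ 2 * (A * t ^ (1 / 4 : ℝ)) * l2norm f := by
  obtain ⟨hw, hwn⟩ := memLp_wideGauss ht x
  have hae : ∀ᵐ y ∂(volume : Measure ℝ), ‖φ y‖ ≤ A * ‖wideGauss t (x - y)‖ := by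
    refine ae_of_all _ fun y => ?_
    rw [Real.norm_of_nonneg (wideGauss_pos t _).le]
    exact hφ y
  have hφ2 : MemLp φ 2 volume := hw.of_le_mul hφm hae
  have hle := eLpNorm_le_mul_eLpNorm_of_ae_le_mul hae 2
  have hn : l2norm φ ≤ A * (2 * t ^ (1 / 4 : ℝ)) := by
    have h1 := ENNReal.toReal_mono (ENNReal.mul_ne_top ENNReal.ofReal_ne_top hw.2.ne) hle
    rw [ENNReal.toReal_mul, ENNReal.toReal_ofReal hA] at h1
    exact h1.trans (mul_le_mul_of_nonneg_left hwn hA)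
  obtain ⟨h1, h2⟩ := abs_integral_mul_le_l2norm hφ2 hf
  refine ⟨h1, h2.trans ?_⟩
  have h3 := mul_le_mul_of_nonneg_right hn (l2norm_nonneg f)
  linarith

/-! ### Weak derivatives against test functions without compact support -/

/-- The heat kernel is not compactly supported, so `φ` is multiplied by the cutoffs `χ(y/(n+1))`.
Their derivatives are bounded by `C/(n+1)`, and dominated convergence removes them. -/
theorem HasH1Deriv.integral_mul_deriv {f g : ℝ → ℝ} (h : HasH1Deriv f g) {φ : ℝ → ℝ}
    (hφ : ContDiff ℝ ((⊤ : ℕ∞) : WithTop ℕ∞) φ) (hφ2 : MemLp φ 2 volume)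
    (hφ' : MemLp (deriv φ) 2 volume) :
    ∫ x, f x * deriv φ x = -∫ x, g x * φ x := by
  let χ : ContDiffBump (0 : ℝ) := ⟨1, 2, one_pos, one_lt_two⟩
  have hχs : ContDiff ℝ ((⊤ : ℕ∞) : WithTop ℕ∞) χ := χ.contDiff
  have hχd : Differentiable ℝ χ := hχs.differentiable (by simp)
  have hχ'c : Continuous (deriv χ) := hχs.continuous_deriv (by simp)
  obtain ⟨C, hC⟩ := χ.hasCompactSupport.deriv.exists_bound_of_continuous hχ'c
  have hC0 : 0 ≤ C := (norm_nonneg _).trans (hC 0)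
  have hφd : Differentiable ℝ φ := hφ.differentiable (by simp)
  have hφ'c : Continuous (deriv φ) := hφ.continuous_deriv (by simp)
  set ψ : ℕ → ℝ → ℝ := fun n y => χ (y / (n + 1)) with hψ
  have hψs : ∀ n, ContDiff ℝ ((⊤ : ℕ∞) : WithTop ℕ∞) (ψ n) := fun n =>
    hχs.comp (contDiff_id.div_const _)
  have hψc : ∀ n, HasCompactSupport (ψ n) := by
    intro n
    have h1 : (0 : ℝ) < n + 1 := by positivity
    have := χ.hasCompactSupport.comp_homeomorph (Homeomorph.mulRight₀ ((n : ℝ) + 1)⁻¹ (by positivity))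
    exact this
  have hψd : ∀ n y, deriv (ψ n) y = deriv χ (y / (n + 1)) / (n + 1) := by
    intro n y
    have h1 := (hχd (y / (n + 1))).hasDerivAt.comp y ((hasDerivAt_id y).div_const ((n : ℝ) + 1))
    have h2 := h1.deriv
    rw [mul_one_div] at h2
    exact h2
  have hψ1 : ∀ n y, |ψ n y| ≤ 1 := by
    intro n y
    rw [abs_of_nonneg χ.nonneg]
    exact χ.le_one
  have hψlim : ∀ y, Tendsto (fun n => ψ n y) atTop (𝓝 1) := by
    intro y
    refine tendsto_const_nhds.congr' ?_
    obtain ⟨N, hN⟩ := exists_nat_ge |y|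
    filter_upwards [eventually_ge_atTop N] with n hn
    have hnN : (N : ℝ) ≤ n := by exact_mod_cast hn
    refine (χ.one_of_mem_closedBall ?_).symm
    rw [mem_closedBall_zero_iff, Real.norm_eq_abs, abs_div,
      abs_of_pos (show (0 : ℝ) < n + 1 by positivity), div_le_iff₀ (by positivity)]
    change |y| ≤ 1 * _
    linarith
  have hψ'lim : ∀ y, Tendsto (fun n => deriv (ψ n) y) atTop (𝓝 0) := by
    intro y
    refine squeeze_zero_norm (a := fun n : ℕ => C / ((n : ℝ) + 1)) (fun n => ?_) ?_
    · rw [hψd, norm_div, Real.norm_of_nonneg (show (0 : ℝ) ≤ n + 1 by positivity)]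
      gcongr
      exact hC _
    · have := (tendsto_one_div_add_atTop_nhds_zero_nat (𝕜 := ℝ)).const_mul C
      simpa [div_eq_mul_inv] using this
  have hψ'b : ∀ n y, |deriv (ψ n) y| ≤ C := by
    intro n y
    rw [hψd, abs_div, abs_of_pos (show (0 : ℝ) < n + 1 by positivity)]
    refine (div_le_self (abs_nonneg _) ?_).trans (hC _)
    have := n.cast_nonneg (α := ℝ)
    linarith
  have hweak : ∀ n, ∫ x, (f x * deriv φ x * ψ n x + f x * φ x * deriv (ψ n) x) =
      -∫ x, g x * φ x * ψ n x := by
    intro n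
    have h1 := h.weak_deriv (fun y => φ y * ψ n y) (hφ.mul (hψs n)) ((hψc n).mul_left)
    have h2 : ∀ x, deriv (fun y => φ y * ψ n y) x = deriv φ x * ψ n x + φ x * deriv (ψ n) x :=
      fun x => deriv_fun_mul (hφd x) ((hψs n).differentiable (by simp) x)
    simp only [h2, mul_add, ← mul_assoc] at h1
    exact h1
  have hi1 : Integrable fun x => f x * deriv φ x :=
    (abs_integral_mul_le_l2norm h.memLp hφ').1
  have hi2 : Integrable fun x => f x * φ x := (abs_integral_mul_le_l2norm h.memLp hφ2).1
  have hi3 : Integrable fun x => g x * φ x := (abs_integral_mul_le_l2norm h.memLp_deriv hφ2).1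
  have hlimL : Tendsto (fun n => ∫ x, (f x * deriv φ x * ψ n x + f x * φ x * deriv (ψ n) x)) atTop
      (𝓝 (∫ x, f x * deriv φ x)) := by
    refine tendsto_integral_of_dominated_convergence
      (fun x => |f x * deriv φ x| + |f x * φ x| * C) (fun n => ?_)
      (hi1.norm.add (hi2.norm.mul_const C)) (fun n => ae_of_all _ fun x => ?_)
      (ae_of_all _ fun x => ?_)
    · exact (hi1.1.mul (hψs n).continuous.aestronglyMeasurable).add
        (hi2.1.mul ((hψs n).continuous_deriv (by simp)).aestronglyMeasurable)
    · refine (norm_add_le _ _).trans ?_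
      rw [norm_mul _ (ψ n x), norm_mul _ (deriv (ψ n) x)]
      refine add_le_add (mul_le_of_le_one_right (norm_nonneg _) (hψ1 n x)) ?_
      exact mul_le_mul_of_nonneg_left (hψ'b n x) (norm_nonneg _)
    · simpa using ((hψlim x).const_mul (f x * deriv φ x)).add
        ((hψ'lim x).const_mul (f x * φ x))
  have hlimR : Tendsto (fun n => -∫ x, g x * φ x * ψ n x) atTop (𝓝 (-∫ x, g x * φ x)) := by
    refine Tendsto.neg (tendsto_integral_of_dominated_convergence
      (fun x => |g x * φ x|) (fun n => ?_) hi3.norm (fun n => ae_of_all _ fun x => ?_)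
      (ae_of_all _ fun x => ?_))
    · exact hi3.1.mul (hψs n).continuous.aestronglyMeasurable
    · rw [norm_mul]
      exact mul_le_of_le_one_right (norm_nonneg _) (hψ1 n x)
    · simpa using (hψlim x).const_mul (g x * φ x)
  exact tendsto_nhds_unique (hlimL.congr hweak) hlimR

/-! ### The diffusion semigroup at a fixed point -/

section Semigroup

variable {f g : ℝ → ℝ}

theorem integrable_heatKernel_mul (hf : MemLp f 2 volume) {t : ℝ} (ht : 0 < t) (x : ℝ) :
    Integrable (fun y => heatKernel t (x - y) * f y) ∧
      |heatSemigroup t f x| ≤ 2 * t ^ (-1 / 4 : ℝ) * l2norm f := by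
  have hm : AEStronglyMeasurable (fun y => heatKernel t (x - y)) volume :=
    ((continuous_heatKernel_space t).comp (continuous_const.sub continuous_id)).aestronglyMeasurable
  have h := gauss_mul_integral_le ht (by positivity) hm
    (fun y => heatKernel_le_wideGauss ht (x - y)) hf
  rw [← Real.rpow_add ht] at h
  norm_num at h ⊢
  exact h

theorem hasDerivAt_heatSemigroup (hf : MemLp f 2 volume) {t : ℝ} (ht : 0 < t) (x : ℝ) :
    HasDerivAt (fun s => heatSemigroup s f x)
      (∫ y, heatKernel t (x - y) * ((x - y) ^ 2 / (4 * t ^ 2) - 1 / (2 * t)) * f y) t := by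
  have hk : ∀ s : ℝ, Continuous fun y => heatKernel s (x - y) := fun s =>
    (continuous_heatKernel_space s).comp (continuous_const.sub continuous_id)
  have hwc : Continuous fun y => wideGauss (2 * t) (x - y) := by unfold wideGauss; fun_prop
  -- On the time window `(t/2, 2t)` the power is largest at the left end and the wide Gaussian at
  -- the right end, which gives a dominating function independent of time.
  set A : ℝ := (t / 2) ^ (-3 / 2 : ℝ) with hA
  refine (hasDerivAt_integral_of_dominated_loc_of_deriv_le (s := Ioo (t / 2) (2 * t))
    (F := fun s y => heatKernel s (x - y) * f y)
    (F' := fun s y => heatKernel s (x - y) * ((x - y) ^ 2 / (4 * s ^ 2) - 1 / (2 * s)) * f y)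
    (bound := fun y => A * wideGauss (2 * t) (x - y) * |f y|)
    (Ioo_mem_nhds (by linarith) (by linarith)) ?_ (integrable_heatKernel_mul hf ht x).1 ?_ ?_ ?_
    ?_).2
  · exact Eventually.of_forall fun s => (hk s).aestronglyMeasurable.mul hf.1
  · exact (Continuous.aestronglyMeasurable ((hk t).mul (by fun_prop))).mul hf.1
  · refine ae_of_all _ fun y s hs => ?_
    have hs0 : 0 < s := lt_trans (by positivity) hs.1
    rw [norm_mul, Real.norm_eq_abs, Real.norm_eq_abs]
    refine mul_le_mul_of_nonneg_right ((heatKernel_time_deriv_le hs0 (x - y)).trans ?_)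
      (abs_nonneg _)
    have h1 : s ^ (-3 / 2 : ℝ) ≤ A :=
      Real.rpow_le_rpow_of_nonpos (by positivity) hs.1.le (by norm_num)
    have h2 : wideGauss s (x - y) ≤ wideGauss (2 * t) (x - y) := by
      unfold wideGauss
      have := hs.2.le
      gcongr
    have h3 := (wideGauss_pos s (x - y)).le
    gcongr
  · refine (gauss_mul_integral_le (t := 2 * t) (x := x) (A := A) (by positivity) (by positivity)
      (Continuous.aestronglyMeasurable (by fun_prop)) (fun y => le_of_eq ?_) hf.norm).1
    exact abs_of_nonneg (mul_nonneg (by positivity) (wideGauss_pos _ _).le)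
  · refine ae_of_all _ fun y s hs => ?_
    have hs0 : 0 < s := lt_trans (by positivity) hs.1
    exact (hasDerivAt_heatKernel_time hs0 (x - y)).mul_const (f y)

/-- Time derivative of the diffusion semigroup at a fixed point. -/
def semigroupDeriv (f : ℝ → ℝ) (x t : ℝ) : ℝ := deriv (fun s => heatSemigroup s f x) t

theorem measurable_semigroupDeriv (f : ℝ → ℝ) (x : ℝ) : Measurable (semigroupDeriv f x) :=
  measurable_deriv _

/-- The exponent is `-3/2 + 1/4`: two space derivatives fall on the kernel and Cauchy-Schwarz
returns `t^(1/4)`. The bound is integrable at infinity but not at zero. -/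
theorem abs_semigroupDeriv_le (hf : MemLp f 2 volume) {t : ℝ} (ht : 0 < t) (x : ℝ) :
    |semigroupDeriv f x t| ≤ 2 * t ^ (-5 / 4 : ℝ) * l2norm f := by
  rw [semigroupDeriv, (hasDerivAt_heatSemigroup hf ht x).deriv]
  have hm : AEStronglyMeasurable
      (fun y => heatKernel t (x - y) * ((x - y) ^ 2 / (4 * t ^ 2) - 1 / (2 * t))) volume :=
    Continuous.aestronglyMeasurable (((continuous_heatKernel_space t).comp
      (continuous_const.sub continuous_id)).mul (by fun_prop))
  have h := (gauss_mul_integral_le ht (by positivity) hm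
    (fun y => heatKernel_time_deriv_le ht (x - y)) hf).2
  rw [← Real.rpow_add ht] at h
  norm_num at h ⊢
  exact h

/-- By the heat equation the time derivative of the kernel is a second space derivative. Moving one
of these onto `f` leaves the exponent `-1 + 1/4`, which is integrable at zero. -/
theorem HasH1Deriv.abs_semigroupDeriv_le (h : HasH1Deriv f g) {t : ℝ} (ht : 0 < t) (x : ℝ) :
    |semigroupDeriv f x t| ≤ 2 * t ^ (-3 / 4 : ℝ) * l2norm g := by
  rw [semigroupDeriv, (hasDerivAt_heatSemigroup h.memLp ht x).deriv]
  set φ : ℝ → ℝ := fun y => heatKernel t (x - y) * (-((x - y) / (2 * t))) with hφ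
  have hφd : deriv φ = fun y =>
      -(heatKernel t (x - y) * ((x - y) ^ 2 / (4 * t ^ 2) - 1 / (2 * t))) := by
    ext y
    have := (hasDerivAt_heatKernel_space_deriv ht (x - y)).comp y ((hasDerivAt_id y).const_sub x)
    rw [mul_neg_one] at this
    exact this.deriv
  have hks : ContDiff ℝ ((⊤ : ℕ∞) : WithTop ℕ∞) (heatKernel t) := by
    unfold heatKernel; fun_prop
  have hφs : ContDiff ℝ ((⊤ : ℕ∞) : WithTop ℕ∞) φ :=
    (hks.comp (contDiff_const.sub contDiff_id)).mul (by fun_prop)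
  have hb1 : ∀ y, |φ y| ≤ t ^ (-1 : ℝ) * wideGauss t (x - y) := fun y =>
    heatKernel_space_deriv_le ht (x - y)
  have hb2 : ∀ y, |deriv φ y| ≤ t ^ (-3 / 2 : ℝ) * wideGauss t (x - y) := by
    intro y
    rw [hφd, abs_neg]
    exact heatKernel_time_deriv_le ht (x - y)
  have hw := (memLp_wideGauss ht x).1
  have hL1 : MemLp φ 2 volume := hw.of_le_mul hφs.continuous.aestronglyMeasurable
    (ae_of_all _ fun y => by
      rw [Real.norm_of_nonneg (wideGauss_pos t _).le]; exact hb1 y)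
  have hL2 : MemLp (deriv φ) 2 volume :=
    hw.of_le_mul (hφs.continuous_deriv (by simp)).aestronglyMeasurable
      (ae_of_all _ fun y => by
        rw [Real.norm_of_nonneg (wideGauss_pos t _).le]; exact hb2 y)
  have hi := h.integral_mul_deriv hφs hL1 hL2
  have e1 : ∫ y, heatKernel t (x - y) * ((x - y) ^ 2 / (4 * t ^ 2) - 1 / (2 * t)) * f y =
      ∫ y, φ y * g y := by
    have e2 : ∫ y, φ y * g y = ∫ y, g y * φ y := by simp only [mul_comm]
    rw [e2, ← neg_neg (∫ y, g y * φ y), ← hi, ← integral_neg]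
    refine integral_congr_ae (ae_of_all _ fun y => ?_)
    simp only [hφd]
    ring
  rw [e1]
  have h2 := (gauss_mul_integral_le ht (by positivity) hφs.continuous.aestronglyMeasurable hb1
    h.memLp_deriv).2
  rw [← Real.rpow_add ht] at h2
  norm_num at h2 ⊢
  exact h2

theorem tendsto_heatSemigroup_atTop (hf : MemLp f 2 volume) (x : ℝ) :
    Tendsto (fun t => heatSemigroup t f x) atTop (𝓝 0) := by
  refine squeeze_zero_norm' (a := fun t => 2 * t ^ (-1 / 4 : ℝ) * l2norm f) ?_ ?_
  · filter_upwards [eventually_gt_atTop 0] with t ht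
    exact (integrable_heatKernel_mul hf ht x).2
  · have := tendsto_rpow_neg_atTop (y := 1 / 4) (by norm_num)
    have h2 := (this.const_mul 2).mul_const (l2norm f)
    norm_num at h2 ⊢
    exact h2

/-- As `f` is only square integrable, it is cut at distance one from `x`. The near part is
integrable, and `K(t,·)` is the rescaling of `K(1,·)` by `t^(-1/2)`, an approximate identity. The
far part is small by `heatKernel_le_of_one_le_abs`. -/
theorem tendsto_heatSemigroup_zero (hfc : Continuous f) (hf : MemLp f 2 volume) (x : ℝ) :
    Tendsto (fun t => heatSemigroup t f x) (𝓝[>] 0) (𝓝 (f x)) := by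
  set B := Metric.ball x 1 with hB
  set f₁ := B.indicator f with hf₁
  set f₂ := Bᶜ.indicator f with hf₂
  have hsum : ∀ y, f y = f₁ y + f₂ y := fun y => (indicator_self_add_compl_apply B f y).symm
  have hf₁L : MemLp f₁ 2 volume := hf.indicator measurableSet_ball
  have hf₂L : MemLp f₂ 2 volume := hf.indicator measurableSet_ball.compl
  have h1 : Tendsto (fun t => heatSemigroup t f₁ x) (𝓝[>] 0) (𝓝 (f x)) := by
    have hint : Integrable f₁ := by
      rw [hf₁, integrable_indicator_iff measurableSet_ball]
      exact (hfc.integrableOn_Icc (a := x - 1) (b := x + 1)).mono_set (by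
        rw [Real.ball_eq_Ioo]; exact Ioo_subset_Icc_self)
    have hx : f₁ x = f x := indicator_of_mem (Metric.mem_ball_self one_pos) f
    have hca : ContinuousAt f₁ x := by
      refine hfc.continuousAt.congr ?_
      filter_upwards [Metric.ball_mem_nhds x one_pos] with y hy
      exact (indicator_of_mem hy f).symm
    have hpi : 0 < 4 * Real.pi := by positivity
    have hk1 : ∀ z, heatKernel 1 z = Real.exp (-(1 / 4) * z ^ 2) / √(4 * Real.pi) := by
      intro z; rw [heatKernel]; ring_nf
    have hpeak := tendsto_integral_comp_smul_smul_of_integrable' (μ := volume)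
      (φ := fun z : ℝ => heatKernel 1 z) (x₀ := x) (fun z => heatKernel_nonneg 1 z) ?_ ?_ hint hca
    · have hc : Tendsto (fun t : ℝ => (√t)⁻¹) (𝓝[>] 0) atTop := by
        refine (tendsto_div_two_sqrt_zero (y := 2) two_pos).congr fun t => ?_
        rw [← one_div]; ring
      rw [← hx]
      refine (hpeak.comp hc).congr' ?_
      filter_upwards [self_mem_nhdsWithin] with t ht
      have ht0 : 0 < t := ht
      have hs := Real.sqrt_pos.2 ht0
      simp only [Function.comp, heatSemigroup, smul_eq_mul, Module.finrank_self, pow_one]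
      congr 1; ext y; congr 1
      rw [hk1, heatKernel, mul_pow, inv_pow, Real.sq_sqrt ht0.le, Real.sqrt_mul hpi.le t]
      field_simp
    · simp only [hk1]
      rw [integral_div, integral_gaussian, div_div_eq_mul_div, div_one, mul_comm Real.pi,
        div_self (Real.sqrt_pos.2 hpi).ne']
    · have h2 : Tendsto (fun z : ℝ => 8 * ‖z‖⁻¹) (Bornology.cobounded ℝ) (𝓝 0) := by
        have h3 := (tendsto_inv_atTop_zero.comp
          (tendsto_norm_cobounded_atTop (E := ℝ))).const_mul 8
        rw [mul_zero] at h3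
        exact h3
      refine squeeze_zero' (Eventually.of_forall fun z => mul_nonneg (by positivity)
        (heatKernel_nonneg 1 z)) ?_ h2
      filter_upwards [eventually_cobounded_le_norm (E := ℝ) 1] with z hz
      have hz0 : 0 < ‖z‖ := by linarith
      have h3 := heatKernel_mul_le one_pos (z := z) (m := z ^ 2) (B := 8) (by norm_num) (by
        rw [abs_of_nonneg (sq_nonneg z)]; nlinarith [sq_nonneg z])
      rw [Real.sqrt_one] at h3
      have h4 : wideGauss 1 z ≤ 1 := Real.exp_le_one_iff.2 (by
        rw [Left.neg_nonpos_iff]; positivity)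
      have h5 := (le_abs_self _).trans h3
      rw [← Real.norm_eq_abs] at *
      rw [Module.finrank_self, pow_one, ← div_eq_mul_inv, le_div_iff₀ hz0]
      have h6 : ‖z‖ * heatKernel 1 z * ‖z‖ = heatKernel 1 z * z ^ 2 := by
        rw [Real.norm_eq_abs, ← sq_abs z]; ring
      rw [h6]
      linarith [wideGauss_pos 1 z]
  have h2 : Tendsto (fun t => heatSemigroup t f₂ x) (𝓝[>] 0) (𝓝 0) := by
    refine squeeze_zero_norm' (a := fun t => 2 * (8 * t ^ (1 / 2 : ℝ) * t ^ (1 / 4 : ℝ)) * l2norm f₂)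
      ?_ ?_
    · filter_upwards [self_mem_nhdsWithin] with t ht
      have ht0 : 0 < t := ht
      have e : heatSemigroup t f₂ x =
          ∫ y, (Bᶜ.indicator (fun y => heatKernel t (x - y)) y) * f₂ y := by
        rw [heatSemigroup]
        congr 1; ext y
        by_cases hy : y ∈ Bᶜ
        · rw [indicator_of_mem hy]
        · rw [hf₂, indicator_of_notMem hy, mul_zero, mul_zero]
      rw [e]
      refine (gauss_mul_integral_le (x := x) ht0 (by positivity) ?_ (fun y => ?_) hf₂L).2
      · exact (Continuous.aestronglyMeasurable ((continuous_heatKernel_space t).comp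
          (continuous_const.sub continuous_id))).indicator measurableSet_ball.compl
      · by_cases hy : y ∈ Bᶜ
        · rw [indicator_of_mem hy]
          refine heatKernel_le_of_one_le_abs ht0 ?_
          rw [hB, mem_compl_iff, Metric.mem_ball, not_lt, dist_comm, Real.dist_eq] at hy
          exact hy
        · rw [indicator_of_notMem hy, abs_zero]
          exact mul_nonneg (by positivity) (wideGauss_pos _ _).le
    · have hc : ContinuousAt
          (fun t : ℝ => 2 * (8 * t ^ (1 / 2 : ℝ) * t ^ (1 / 4 : ℝ)) * l2norm f₂) 0 := by
        have e1 : ContinuousAt (fun t : ℝ => t ^ (1 / 2 : ℝ)) 0 :=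
          Real.continuousAt_rpow_const _ _ (Or.inr (by norm_num))
        have e2 : ContinuousAt (fun t : ℝ => t ^ (1 / 4 : ℝ)) 0 :=
          Real.continuousAt_rpow_const _ _ (Or.inr (by norm_num))
        fun_prop
      have := hc.tendsto.mono_left (nhdsWithin_le_nhds (s := Ioi 0))
      simpa [Real.zero_rpow] using this
  have h3 := h1.add h2
  rw [add_zero] at h3
  refine h3.congr' ?_
  filter_upwards [self_mem_nhdsWithin] with t ht
  rw [heatSemigroup, heatSemigroup, heatSemigroup, ← integral_add
    (integrable_heatKernel_mul hf₁L ht x).1 (integrable_heatKernel_mul hf₂L ht x).1]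
  congr 1; ext y
  rw [hsum y, mul_add]

theorem HasH1Deriv.integrableOn_semigroupDeriv (h : HasH1Deriv f g) (x : ℝ) :
    IntegrableOn (semigroupDeriv f x) (Ioi 0) := by
  rw [← Ioc_union_Ioi_eq_Ioi (zero_le_one (α := ℝ))]
  refine IntegrableOn.union ?_ ?_
  · have h1 : IntegrableOn (fun t : ℝ => 2 * t ^ (-3 / 4 : ℝ) * l2norm g) (Ioc 0 1) := by
      have := (intervalIntegral.intervalIntegrable_rpow' (a := 0) (b := 1) (r := -3 / 4)
        (by norm_num))
      rw [intervalIntegrable_iff_integrableOn_Ioc_of_le zero_le_one] at this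
      exact (this.const_mul 2).mul_const _
    refine Integrable.mono' h1 (measurable_semigroupDeriv f x).aestronglyMeasurable ?_
    exact (ae_restrict_iff' measurableSet_Ioc).2
      (ae_of_all _ fun t ht => h.abs_semigroupDeriv_le ht.1 x)
  · have h1 : IntegrableOn (fun t : ℝ => 2 * t ^ (-5 / 4 : ℝ) * l2norm f) (Ioi 1) :=
      ((integrableOn_Ioi_rpow_of_lt (by norm_num) one_pos).const_mul 2).mul_const _
    refine Integrable.mono' h1 (measurable_semigroupDeriv f x).aestronglyMeasurable ?_
    exact (ae_restrict_iff' measurableSet_Ioi).2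
      (ae_of_all _ fun t ht => PointSource.abs_semigroupDeriv_le h.memLp
        (one_pos.trans (mem_Ioi.1 ht)) x)

theorem HasH1Deriv.integral_semigroupDeriv (h : HasH1Deriv f g) (hfc : Continuous f) (x : ℝ)
    {t : ℝ} (ht : 0 < t) :
    ∫ s in (0 : ℝ)..t, semigroupDeriv f x s = heatSemigroup t f x - f x := by
  have hd : ∀ s, 0 < s → HasDerivAt (fun s => heatSemigroup s f x) (semigroupDeriv f x s) s :=
    fun s hs => (hasDerivAt_heatSemigroup h.memLp hs x).differentiableAt.hasDerivAt
  refine intervalIntegral.integral_eq_sub_of_hasDerivAt_of_tendsto ht (fun s hs => hd s hs.1) ?_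
    (tendsto_heatSemigroup_zero hfc h.memLp x)
    ((hd t ht).continuousAt.tendsto.mono_left nhdsWithin_le_nhds)
  rw [intervalIntegrable_iff_integrableOn_Ioc_of_le ht.le]
  exact (h.integrableOn_semigroupDeriv x).mono_set Ioc_subset_Ioi_self

/-- The Sobolev embedding of `H¹(ℝ)` into the bounded functions. -/
theorem HasH1Deriv.abs_le (h : HasH1Deriv f g) (hfc : Continuous f) (x : ℝ) :
    |f x| ≤ 2 * l2norm f + 8 * l2norm g := by
  -- Here `f x` is the semigroup at time `1` minus the integral of its time derivative; the constant
  -- `8` is `2 ∫₀¹ s^(-3/4) ds`.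
  have h1 := h.integral_semigroupDeriv hfc x one_pos
  have h2 := (integrable_heatKernel_mul h.memLp one_pos x).2
  have h3 : |∫ s in (0 : ℝ)..1, semigroupDeriv f x s| ≤
      ∫ s in (0 : ℝ)..1, 2 * s ^ (-3 / 4 : ℝ) * l2norm g := by
    rw [← Real.norm_eq_abs]
    refine intervalIntegral.norm_integral_le_of_norm_le zero_le_one
      (ae_of_all _ fun s hs => (Real.norm_eq_abs _).trans_le (h.abs_semigroupDeriv_le hs.1 x)) ?_
    exact ((intervalIntegral.intervalIntegrable_rpow' (by norm_num)).const_mul 2).mul_const _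
  rw [intervalIntegral.integral_mul_const, intervalIntegral.integral_const_mul,
    integral_rpow (Or.inl (by norm_num)), h1] at h3
  rw [Real.one_rpow] at h2
  norm_num at h3
  rw [_root_.abs_le] at h2 h3 ⊢
  constructor <;> linarith [h2.1, h2.2, h3.1, h3.2]

end Semigroup

/-! ### Linear Volterra equations -/

/-- `f` is integrable and bounded on `(0, t]`. -/
def BddIntegrable (t : ℝ) (f : ℝ → ℝ) : Prop :=
  IntegrableOn f (Ioc 0 t) ∧ ∃ C, ∀ x ∈ Ioc 0 t, |f x| ≤ C

theorem BddIntegrable.add_mul {t c : ℝ} {f₁ f₂ : ℝ → ℝ} (h₁ : BddIntegrable t f₁)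
    (h₂ : BddIntegrable t f₂) : BddIntegrable t fun x => f₁ x + c * f₂ x := by
  obtain ⟨i₁, C₁, b₁⟩ := h₁
  obtain ⟨i₂, C₂, b₂⟩ := h₂
  refine ⟨i₁.add (i₂.const_mul c), C₁ + |c| * C₂, fun x hx => (abs_add_le _ _).trans ?_⟩
  rw [abs_mul]
  exact add_le_add (b₁ x hx) (mul_le_mul_of_nonneg_left (b₂ x hx) (abs_nonneg c))

theorem BddIntegrable.mono {s t : ℝ} {f : ℝ → ℝ} (h : BddIntegrable t f) (hst : s ≤ t) :
    BddIntegrable s f :=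
  ⟨h.1.mono_set (Ioc_subset_Ioc_right hst), h.2.imp fun _ hC x hx => hC x ⟨hx.1, hx.2.trans hst⟩⟩

theorem BddIntegrable.congr {t : ℝ} {f g : ℝ → ℝ} (h : BddIntegrable t f)
    (hfg : ∀ x ∈ Ioc 0 t, f x = g x) : BddIntegrable t g :=
  ⟨h.1.congr_fun hfg measurableSet_Ioc, h.2.imp fun _ hC x hx => hfg x hx ▸ hC x hx⟩

theorem BddIntegrable.const (t c : ℝ) : BddIntegrable t fun _ => c :=
  ⟨integrableOn_const (by simp), |c|, fun _ _ => le_rfl⟩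

theorem BddIntegrable.conv {t : ℝ} {f g : ℝ → ℝ} (hf : BddIntegrable t f)
    (hg : IntegrableOn g (Ioc 0 t)) : BddIntegrable t (conv f g) := by
  obtain ⟨hfi, C, hC⟩ := hf
  refine ⟨integrableOn_Ioc_conv hfi hg, C * ∫ x in Ioc 0 t, |g x|, fun x hx => ?_⟩
  have hC0 : 0 ≤ C := (abs_nonneg _).trans (hC x hx)
  rw [conv_comm, PointSource.conv, intervalIntegral.integral_of_le hx.1.le,
    integral_Ioc_eq_integral_Ioo]
  have hgx : IntegrableOn g (Ioo 0 x) :=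
    hg.mono_set (Ioo_subset_Ioc_self.trans (Ioc_subset_Ioc_right hx.2))
  rw [← Real.norm_eq_abs]
  calc ‖∫ τ in Ioo 0 x, g τ * f (x - τ)‖ ≤ ∫ τ in Ioo 0 x, |g τ| * C := by
        refine norm_integral_le_of_norm_le (hgx.norm.mul_const C)
          ((ae_restrict_iff' measurableSet_Ioo).2 (ae_of_all _ fun τ hτ => ?_))
        rw [norm_mul]
        exact mul_le_mul_of_nonneg_left (hC _ ⟨by linarith [hτ.2], by linarith [hτ.1, hx.2]⟩)
          (norm_nonneg _)
    _ = C * ∫ τ in Ioo 0 x, |g τ| := by rw [integral_mul_const, mul_comm]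
    _ ≤ C * ∫ τ in Ioc 0 t, |g τ| := by
        refine mul_le_mul_of_nonneg_left (setIntegral_mono_set hg.norm
          (ae_of_all _ fun τ => abs_nonneg _) (LE.le.eventuallyLE ?_)) hC0
        exact Ioo_subset_Ioc_self.trans (Ioc_subset_Ioc_right hx.2)

theorem BddIntegrable.intervalIntegrable {t : ℝ} {f g : ℝ → ℝ} (ht : 0 ≤ t)
    (hf : BddIntegrable t f) (hg : IntegrableOn g (Ioc 0 t)) :
    IntervalIntegrable (fun τ => f τ * g (t - τ)) volume 0 t :=
  let ⟨_, hC⟩ := hf.2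
  intervalIntegrable_conv_integrand ht hf.1 hg hC

theorem BddIntegrable.conv_assoc {t : ℝ} {f g h : ℝ → ℝ} (ht : 0 ≤ t) (hf : BddIntegrable t f)
    (hg : IntegrableOn g (Ioc 0 t)) (hh : IntegrableOn h (Ioc 0 t)) :
    PointSource.conv (PointSource.conv f g) h t = PointSource.conv f (PointSource.conv g h) t :=
  let ⟨_, hC⟩ := hf.2
  PointSource.conv_assoc ht hf.1 hg hh hC

theorem conv_add_mul_left {t c : ℝ} {f₁ f₂ g : ℝ → ℝ} (ht : 0 ≤ t) (h₁ : BddIntegrable t f₁)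
    (h₂ : BddIntegrable t f₂) (hg : IntegrableOn g (Ioc 0 t)) :
    conv (fun x => f₁ x + c * f₂ x) g t = conv f₁ g t + c * conv f₂ g t := by
  unfold conv
  rw [← intervalIntegral.integral_const_mul, ← intervalIntegral.integral_add
    (h₁.intervalIntegrable ht hg) ((h₂.intervalIntegrable ht hg).const_mul c)]
  congr 1; ext τ; ring

theorem conv_add_mul_right {t c : ℝ} {f g₁ g₂ : ℝ → ℝ} (ht : 0 ≤ t) (hf : BddIntegrable t f)
    (h₁ : IntegrableOn g₁ (Ioc 0 t)) (h₂ : IntegrableOn g₂ (Ioc 0 t)) :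
    conv f (fun x => g₁ x + c * g₂ x) t = conv f g₁ t + c * conv f g₂ t := by
  unfold conv
  rw [← intervalIntegral.integral_const_mul, ← intervalIntegral.integral_add
    (hf.intervalIntegrable ht h₁) ((hf.intervalIntegrable ht h₂).const_mul c)]
  congr 1; ext τ; ring

/-- Solution of a linear Volterra equation through the resolvent `p` of its kernel `k`. -/
theorem volterra_solution {a t : ℝ} {k p v h Φ : ℝ → ℝ} (ht : 0 < t) (hk : BddIntegrable t k)
    (hp : IntegrableOn p (Ioc 0 t)) (hv : BddIntegrable t v) (hΦ : IntegrableOn Φ (Ioc 0 t))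
    (hres : ∀ᵐ s ∂(volume.restrict (Ioo 0 t)), p s + 2 * a * conv k p s = k s)
    (hvolt : ∀ s ∈ Ioc 0 t, v s = h s + 2 * conv k (fun τ => Φ τ - a * v τ) s) :
    v t = h t - 2 * a * conv p h t + 2 * conv p Φ t := by
  have ht0 := ht.le
  have htm : t ∈ Ioc 0 t := ⟨ht, le_rfl⟩
  have hlin : ∀ s ∈ Ioc 0 t, conv k (fun τ => Φ τ - a * v τ) s =
      conv k Φ s + -a * conv k v s := by
    intro s hs
    rw [← conv_add_mul_right hs.1.le (hk.mono hs.2)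
      (hΦ.mono_set (Ioc_subset_Ioc_right hs.2)) (hv.mono hs.2).1]
    congr 1; ext τ; ring
  have hkv := hk.conv hv.1
  have hkΦ := hk.conv hΦ
  have hkp := hk.conv hp
  have hf : ∀ s ∈ Ioc 0 t, h s + 2 * conv k Φ s = v s + 2 * a * conv k v s := by
    intro s hs
    have := hvolt s hs
    rw [hlin s hs] at this
    linarith
  -- No separate estimate of `h` is needed: the Volterra equation expresses it through bounded
  -- functions.
  have hh : BddIntegrable t h := by
    refine ((hv.add_mul (c := 2 * a) hkv).add_mul (c := -2) hkΦ).congr fun s hs => ?_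
    have := hf s hs
    linarith
  have hpsub : ∀ g : ℝ → ℝ, IntegrableOn g (Ioc 0 t) →
      conv p g t = conv k g t + -(2 * a) * conv (conv k p) g t := by
    intro g hg
    rw [← conv_add_mul_left ht0 hk hkp hg]
    refine conv_congr ht0 ?_ (ae_of_all _ fun _ => rfl)
    filter_upwards [hres] with s hs
    linarith
  have hassoc : ∀ g : ℝ → ℝ, IntegrableOn g (Ioc 0 t) →
      conv (conv k g) p t = conv (conv k p) g t := by
    intro g hg
    rw [hk.conv_assoc ht0 hg hp, hk.conv_assoc ht0 hp hg, funext (conv_comm g p)]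
  -- With `f = h + 2k*Φ = v + 2a k*v`, the resolvent equation gives `p * f = p*v + 2a (k*p)*v = k *
  -- v`. Hence `v = f - 2a p * f`, and one more use of the resolvent equation simplifies the terms
  -- in `Φ`.
  have e1 : conv (fun s => h s + 2 * conv k Φ s) p t = conv k v t := by
    rw [conv_congr_on ht0 (fun s hs => hf s ⟨hs.1, hs.2.le⟩) (fun _ _ => rfl),
      conv_add_mul_left ht0 hv hkv hp, hassoc v hv.1, conv_comm v p, hpsub v hv.1]
    ring
  rw [conv_add_mul_left ht0 hh hkΦ hp, hassoc Φ hΦ, conv_comm h p] at e1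
  have e2 := hpsub Φ hΦ
  have e3 := hf t htm
  linear_combination (-1 : ℝ) * e3 - 2 * e2 + 2 * a * e1

/-! ### Primitives of integrable functions -/

theorem hasL1Deriv_of_eq_primitive {v W : ℝ → ℝ} (hW : IntegrableOn W (Ioi 0))
    (hv : ∀ t, 0 ≤ t → v t = v 0 + ∫ s in (0 : ℝ)..t, W s) : HasL1Deriv v := by
  set W' : ℝ → ℝ := (Ioi (0 : ℝ)).indicator W with hW'
  have hW'i : Integrable W' := (integrable_indicator_iff measurableSet_Ioi).2 hW
  have hprim : ∀ t, 0 ≤ t → v t = v 0 + ∫ s in (0 : ℝ)..t, W' s := by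
    intro t ht
    rw [hv t ht, intervalIntegral.integral_of_le ht, intervalIntegral.integral_of_le ht]
    congr 1
    refine setIntegral_congr_fun measurableSet_Ioc fun s hs => ?_
    rw [hW', indicator_of_mem (mem_Ioi.2 hs.1)]
  constructor
  · intro T hT
    have h1 := (hW'i.intervalIntegrable
      (a := 0) (b := T)).absolutelyContinuousOnInterval_intervalIntegral (c := 0) left_mem_uIcc
    -- On `[0, T]` the function differs from the primitive by a constant, so the sums of increments
    -- defining absolute continuity coincide.
    refine Tendsto.congr' ?_ h1
    filter_upwards [mem_inf_of_right (mem_principal_self _)] with E hE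
    refine Finset.sum_congr rfl fun i hi => ?_
    have hm := hE.1 i hi
    rw [uIcc_of_le hT.le] at hm
    rw [hprim _ hm.1.1, hprim _ hm.2.1, dist_add_left]
  · refine hW.congr_fun_ae ?_
    rw [EventuallyEq, ae_restrict_iff' measurableSet_Ioi]
    filter_upwards [LocallyIntegrable.ae_hasDerivAt_integral hW'i.locallyIntegrable] with t ht htm
    have h1 : HasDerivAt v (W' t) t := by
      refine ((ht 0).const_add (v 0)).congr_of_eventuallyEq ?_
      filter_upwards [Ioi_mem_nhds htm] with s hs
      exact hprim s (mem_Ioi.1 hs).le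
    rw [h1.deriv, hW', indicator_of_mem htm]

/-! ### Point values of the mild solution -/

theorem HasH1Deriv.sub {f₁ g₁ f₂ g₂ : ℝ → ℝ} (h₁ : HasH1Deriv f₁ g₁) (h₂ : HasH1Deriv f₂ g₂) :
    HasH1Deriv (f₁ - f₂) (g₁ - g₂) := by
  refine ⟨h₁.memLp.sub h₂.memLp, h₁.memLp_deriv.sub h₂.memLp_deriv, fun φ hφ hφc => ?_⟩
  have hφL : MemLp φ 2 volume := hφ.continuous.memLp_of_hasCompactSupport hφc
  have hφL' : MemLp (deriv φ) 2 volume :=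
    (hφ.continuous_deriv (by simp)).memLp_of_hasCompactSupport hφc.deriv
  simp only [Pi.sub_apply, sub_mul]
  rw [integral_sub (abs_integral_mul_le_l2norm h₁.memLp hφL').1
    (abs_integral_mul_le_l2norm h₂.memLp hφL').1,
    integral_sub (abs_integral_mul_le_l2norm h₁.memLp_deriv hφL).1
    (abs_integral_mul_le_l2norm h₂.memLp_deriv hφL).1, h₁.weak_deriv φ hφ hφc,
    h₂.weak_deriv φ hφ hφc]
  ring

namespace IsMildSolution

variable {a : ℝ} {Φ u₀ : ℝ → ℝ} {u : ℝ → ℝ → ℝ}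

/-- Point evaluation is bounded on `H¹`, so `HasH1Deriv.abs_le` applied to differences in time
transfers the continuity. -/
theorem continuousOn_eval (hu : IsMildSolution a Φ u₀ u) (x : ℝ) :
    ContinuousOn (fun t => u t x) (Ici 0) := by
  obtain ⟨ux, hux, hcont⟩ := hu.continuous_time
  intro t₀ ht₀
  have ht₀' : 0 ≤ t₀ := ht₀
  set E : ℝ → ℝ≥0∞ := fun t => eLpNorm (u t - u t₀) 2 volume +
      eLpNorm (ux t - ux t₀) 2 volume with hE
  have hE0 : Tendsto (fun t => 8 * (E t).toReal) (𝓝[Ici 0] t₀) (𝓝 0) := by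
    simpa using ((ENNReal.tendsto_toReal ENNReal.zero_ne_top).comp
      (hcont t₀ ht₀')).const_mul 8
  refine tendsto_iff_norm_sub_tendsto_zero.2 (squeeze_zero' (Eventually.of_forall fun _ =>
    norm_nonneg _) ?_ hE0)
  filter_upwards [self_mem_nhdsWithin] with t ht
  have ht' : 0 ≤ t := ht
  have hd := (hux t ht').sub (hux t₀ ht₀')
  have h1 := hd.abs_le ((hu.continuous_space t ht').sub (hu.continuous_space t₀ ht₀')) x
  have h2 : (E t).toReal = l2norm (u t - u t₀) + l2norm (ux t - ux t₀) :=
    ENNReal.toReal_add hd.memLp.2.ne hd.memLp_deriv.2.ne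
  have h3 := l2norm_nonneg (u t - u t₀)
  rw [h2, Real.norm_eq_abs]
  rw [Pi.sub_apply] at h1
  linarith

theorem continuousOn_uPlus (hu : IsMildSolution a Φ u₀ u) : ContinuousOn (uPlus u) (Ici 0) :=
  (hu.continuousOn_eval 1).add (hu.continuousOn_eval (-1))

theorem bddIntegrable_uPlus (hu : IsMildSolution a Φ u₀ u) (t : ℝ) :
    BddIntegrable t (uPlus u) := by
  have hc : ContinuousOn (uPlus u) (Icc 0 t) := hu.continuousOn_uPlus.mono Icc_subset_Ici_self
  obtain ⟨C, hC⟩ := isCompact_Icc.exists_bound_of_continuousOn hc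
  exact ⟨hc.integrableOn_Icc.mono_set Ioc_subset_Icc_self, C,
    fun x hx => hC x (Ioc_subset_Icc_self hx)⟩

/-- The two observation points see the same memory kernel because `K` is even in space, so the
equation closes in `uPlus`. The datum `u₀` is exchanged for its continuous representative `u 0`. -/
theorem uPlus_eq (hu : IsMildSolution a Φ u₀ u) {t : ℝ} (ht : 0 < t) :
    uPlus u t = (heatSemigroup t (u 0) 1 + heatSemigroup t (u 0) (-1)) +
      2 * conv (fun s => heatKernel s 1) (fun τ => Φ τ - a * uPlus u τ) t := by
  have hs : ∀ x, heatSemigroup t u₀ x = heatSemigroup t (u 0) x := by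
    intro x
    refine integral_congr_ae ?_
    filter_upwards [hu.initial] with y hy
    rw [hy]
  have hI : ∀ τ, intensity a Φ u τ = Φ τ - a * uPlus u τ := by
    intro τ; rw [intensity, uPlus, add_comm (u τ 1)]
  have hc : ∫ τ in (0 : ℝ)..t, heatKernel (t - τ) 1 * intensity a Φ u τ =
      conv (fun s => heatKernel s 1) (fun τ => Φ τ - a * uPlus u τ) t := by
    rw [conv_comm, conv]
    congr 1; ext τ; rw [hI, mul_comm]
  have h1 := hu.variation_of_constants t ht 1
  have h2 := hu.variation_of_constants t ht (-1)
  simp only [heatKernel_neg] at h2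
  rw [hs, hc] at h1 h2
  rw [uPlus, h1, h2]
  ring

end IsMildSolution

/-! ### Bounds on the memory kernel and on the source -/

theorem bddIntegrable_heatKernel_one (t : ℝ) : BddIntegrable t fun s => heatKernel s 1 := by
  have hb : ∀ s, |heatKernel s 1| ≤ 2 := fun s => by
    rw [abs_of_nonneg (heatKernel_nonneg s 1)]; exact heatKernel_one_le s
  refine ⟨?_, 2, fun s _ => hb s⟩
  refine Integrable.mono' (g := fun _ => (2 : ℝ)) (integrableOn_const (by simp)) ?_
    (ae_of_all _ hb)
  exact (measurable_heatKernel_uncurry.comp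
    (measurable_id.prodMk measurable_const)).aestronglyMeasurable

theorem MemLpLocHalfLine.integrableOn_Ioc {Φ : ℝ → ℝ} (hΦ : MemLpLocHalfLine Φ ∞) (T : ℝ) :
    IntegrableOn Φ (Ioc 0 T) :=
  (show IntegrableOn Φ (Icc 0 T) volume from (hΦ T).integrable le_top).mono_set Ioc_subset_Icc_self

/-- A locally bounded function with a limit at infinity agrees almost everywhere on `(0, ∞)` with a
bounded one that has the same limit. -/
theorem exists_bounded_representative {Φ Φ' : ℝ → ℝ} {l : ℝ} (hΦ : MemLpLocHalfLine Φ ∞)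
    (hae : Φ' =ᵐ[volume.restrict (Ici 0)] Φ) (hlim : Tendsto Φ' atTop (𝓝 l)) :
    ∃ (Ψ : ℝ → ℝ) (M : ℝ), Ψ =ᵐ[volume.restrict (Ioi 0)] Φ ∧ (∀ t, |Ψ t| ≤ M) ∧
      AEStronglyMeasurable Ψ (volume.restrict (Ioi 0)) ∧ Tendsto Ψ atTop (𝓝 l) := by
  have hae' : Φ' =ᵐ[volume.restrict (Ioi 0)] Φ :=
    ae_restrict_of_ae_restrict_of_subset Ioi_subset_Ici_self hae
  have hev : ∀ᶠ t in atTop, |Φ' t| ≤ |l| + 1 :=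
    (hlim.abs.eventually (gt_mem_nhds (lt_add_one |l|))).mono fun t ht => le_of_lt ht
  obtain ⟨T, hT⟩ := eventually_atTop.1 hev
  set M₀ := (eLpNormEssSup Φ (volume.restrict (Icc 0 T))).toReal with hM₀
  have hb : ∀ᵐ t ∂(volume.restrict (Icc 0 T)), |Φ t| ≤ M₀ := by
    have h1 := (hΦ T).2
    rw [eLpNorm_exponent_top] at h1
    filter_upwards [ae_le_eLpNormEssSup (f := Φ) (μ := volume.restrict (Icc 0 T))] with t ht
    have h2 := ENNReal.toReal_mono h1.ne ht
    rwa [toReal_enorm] at h2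
  -- The representative is `Φ'` clipped at level `M`. The clipping is inactive almost everywhere on
  -- `(0, ∞)`: before `T` by the essential bound of `Φ`, after `T` by convergence.
  set M := max M₀ (|l| + 1) with hM
  have hM0 : 0 ≤ M := le_trans (by positivity) (le_max_right _ _)
  have hclip : ∀ y, |y| ≤ M → max (-M) (min y M) = y := by
    intro y hy
    rw [abs_le] at hy
    rw [min_eq_left hy.2, max_eq_right hy.1]
  have hΨ : (fun t => max (-M) (min (Φ' t) M)) =ᵐ[volume.restrict (Ioi 0)] Φ := by
    rw [EventuallyEq, ae_restrict_iff' measurableSet_Ioi] at hae' ⊢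
    rw [ae_restrict_iff' measurableSet_Icc] at hb
    filter_upwards [hae', hb] with t h1 h2 ht
    rw [← h1 ht]
    refine hclip _ ?_
    rcases le_or_gt T t with h | h
    · exact (hT t h).trans (le_max_right _ _)
    · rw [h1 ht]
      exact (h2 ⟨(mem_Ioi.1 ht).le, h.le⟩).trans (le_max_left _ _)
  have hΦm : AEStronglyMeasurable Φ (volume.restrict (Ioi 0)) := by
    have hU : Ioi (0 : ℝ) = ⋃ n : ℕ, Ioc 0 (n : ℝ) := by
      ext x
      simp only [mem_Ioi, mem_iUnion, mem_Ioc]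
      exact ⟨fun hx => (exists_nat_ge x).imp fun n hn => ⟨hx, hn⟩, fun ⟨_, hx⟩ => hx.1⟩
    rw [hU, aestronglyMeasurable_iUnion_iff]
    exact fun n => (hΦ.integrableOn_Ioc n).aestronglyMeasurable
  refine ⟨_, M, hΨ, fun t => ?_, hΦm.congr hΨ.symm, hlim.congr' ?_⟩
  · rw [abs_le]
    exact ⟨le_max_left _ _, max_le (by linarith) (min_le_right _ _)⟩
  · filter_upwards [eventually_ge_atTop T] with t ht
    exact (hclip _ ((hT t ht).trans (le_max_right _ _))).symm

/-! ### Representation of `uPlus` by the transfer kernel; its limit and its derivative -/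

section Main

variable {a : ℝ} {Φ u₀ : ℝ → ℝ} {u : ℝ → ℝ → ℝ}

theorem uPlus_eq_conv_transferKernel (ha : 0 < a) (hae : a ≤ Real.exp (-1))
    (hΦ : MemLpLocHalfLine Φ ∞) (hu : IsMildSolution a Φ u₀ u) {t : ℝ} (ht : 0 < t) :
    uPlus u t = (heatSemigroup t (u 0) 1 + heatSemigroup t (u 0) (-1)) -
      2 * a * conv (transferKernel a)
        (fun s => heatSemigroup s (u 0) 1 + heatSemigroup s (u 0) (-1)) t +
      2 * conv (transferKernel a) Φ t :=
  volterra_solution ht (bddIntegrable_heatKernel_one t)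
    ((integrableOn_transferKernel ha hae).mono_set Ioc_subset_Ioi_self) (hu.bddIntegrable_uPlus t)
    (hΦ.integrableOn_Ioc t)
    (ae_restrict_of_ae_restrict_of_subset Ioo_subset_Ioi_self (transferKernel_resolvent ha hae))
    fun _ hs => hu.uPlus_eq hs.1

/-- Derivative in time of the sum of the values of the free evolution at `1` and `-1`. -/
def freeDeriv (f : ℝ → ℝ) (t : ℝ) : ℝ := semigroupDeriv f 1 t + semigroupDeriv f (-1) t

theorem HasH1Deriv.integrableOn_freeDeriv {f g : ℝ → ℝ} (h : HasH1Deriv f g) :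
    IntegrableOn (freeDeriv f) (Ioi 0) :=
  (h.integrableOn_semigroupDeriv 1).add (h.integrableOn_semigroupDeriv (-1))

theorem HasH1Deriv.free_eq {f g : ℝ → ℝ} (h : HasH1Deriv f g) (hfc : Continuous f) {t : ℝ}
    (ht : 0 < t) : heatSemigroup t f 1 + heatSemigroup t f (-1) =
      (f 1 + f (-1)) + ∫ s in (0 : ℝ)..t, freeDeriv f s := by
  have hi : ∀ x, IntervalIntegrable (semigroupDeriv f x) volume 0 t := fun x => by
    rw [intervalIntegrable_iff_integrableOn_Ioc_of_le ht.le]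
    exact (h.integrableOn_semigroupDeriv x).mono_set Ioc_subset_Ioi_self
  unfold freeDeriv
  rw [intervalIntegral.integral_add (hi 1) (hi (-1)), h.integral_semigroupDeriv hfc 1 ht,
    h.integral_semigroupDeriv hfc (-1) ht]
  ring

theorem HasH1Deriv.abs_free_le {f g : ℝ → ℝ} (h : HasH1Deriv f g) (hfc : Continuous f) {t : ℝ}
    (ht : 0 < t) : |heatSemigroup t f 1 + heatSemigroup t f (-1)| ≤
      |f 1 + f (-1)| + ∫ s in Ioi (0 : ℝ), |freeDeriv f s| := by
  rw [h.free_eq hfc ht]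
  refine (abs_add_le _ _).trans (add_le_add_right ?_ _)
  rw [intervalIntegral.integral_of_le ht.le]
  rw [← Real.norm_eq_abs]
  refine (norm_integral_le_integral_norm _).trans ?_
  exact setIntegral_mono_set h.integrableOn_freeDeriv.norm (ae_of_all _ fun _ => abs_nonneg _)
    (LE.le.eventuallyLE Ioc_subset_Ioi_self)

/-- In the representation by the transfer kernel `p`, the free part `H` tends to zero and is
bounded, so `p * H` tends to zero as well; only `2 p * Φ` contributes to the limit. -/
theorem tendsto_uPlus (ha : 0 < a) (hae : a ≤ Real.exp (-1)) (hΦ : MemLpLocHalfLine Φ ∞)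
    {Φ' : ℝ → ℝ} {l : ℝ} (hΦ' : Φ' =ᵐ[volume.restrict (Ici 0)] Φ) (hlim : Tendsto Φ' atTop (𝓝 l))
    (hu : IsMildSolution a Φ u₀ u) :
    Tendsto (uPlus u) atTop (𝓝 (2 * l * ∫ t in Ioi (0 : ℝ), transferKernel a t)) := by
  obtain ⟨ux, hux, -⟩ := hu.continuous_time
  have h0 := hux 0 le_rfl
  have hc0 := hu.continuous_space 0 le_rfl
  have hpi := integrableOn_transferKernel ha hae
  set H : ℝ → ℝ := fun s => heatSemigroup s (u 0) 1 + heatSemigroup s (u 0) (-1) with hH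
  have hHlim : Tendsto H atTop (𝓝 0) := by
    simpa using (tendsto_heatSemigroup_atTop h0.memLp 1).add
      (tendsto_heatSemigroup_atTop h0.memLp (-1))
  have hHm : AEStronglyMeasurable H (volume.restrict (Ioi 0)) := by
    refine ContinuousOn.aestronglyMeasurable (fun t ht => ?_) measurableSet_Ioi
    exact ((hasDerivAt_heatSemigroup h0.memLp ht 1).continuousAt.add
      (hasDerivAt_heatSemigroup h0.memLp ht (-1)).continuousAt).continuousWithinAt
  have h1 := tendsto_conv_atTop hpi hHm (fun t ht => h0.abs_free_le hc0 ht) hHlim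
  obtain ⟨Ψ, M, hΨ, hΨM, hΨm, hΨlim⟩ := exists_bounded_representative hΦ hΦ' hlim
  have h2 := tendsto_conv_atTop hpi hΨm (fun t _ => hΨM t) hΨlim
  have h3 := (hHlim.sub (h1.const_mul (2 * a))).add (h2.const_mul 2)
  rw [zero_mul, mul_zero, sub_zero, zero_add, ← mul_assoc] at h3
  refine h3.congr' ?_
  filter_upwards [eventually_gt_atTop 0] with t ht
  rw [uPlus_eq_conv_transferKernel ha hae hΦ hu ht,
    conv_congr ht.le (ae_of_all _ fun _ => rfl)
      (ae_restrict_of_ae_restrict_of_subset Ioo_subset_Ioi_self hΨ)]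

/-- Convolution with `1` is integration. With `H = c + 1 * D`, `p = 1 * m` and `Φ = Ψ + l`,
associativity gives `p * H = 1 * (D * p + c p)` and `p * Φ = 1 * (m * Ψ + l p)`. The derivative
falls on `p` and never on `Φ`, and `W` collects the integrands. -/
theorem hasL1Deriv_uPlus (ha : 0 < a) (hae : a ≤ Real.exp (-1)) (hΦ : MemLpLocHalfLine Φ ∞) {l : ℝ}
    (hl : IntegrableOn (fun t => Φ t - l) (Ioi 0)) (hu : IsMildSolution a Φ u₀ u) :
    HasL1Deriv (uPlus u) := by
  obtain ⟨ux, hux, -⟩ := hu.continuous_time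
  have h0 := hux 0 le_rfl
  have hc0 := hu.continuous_space 0 le_rfl
  set p := transferKernel a with hp
  have hpi : IntegrableOn p (Ioi 0) := integrableOn_transferKernel ha hae
  set D := freeDeriv (u 0) with hD
  have hDi : IntegrableOn D (Ioi 0) := h0.integrableOn_freeDeriv
  set m : ℝ → ℝ := fun t => kernelDeriv t + -(2 * a) * conv kernelDeriv p t with hm
  have hκp := integrableOn_Ioi_conv integrableOn_kernelDeriv hpi
  have hmi : IntegrableOn m (Ioi 0) := integrableOn_kernelDeriv.add (hκp.const_mul _)
  set Ψ : ℝ → ℝ := fun t => Φ t - l with hΨ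
  -- The resolvent equation holds only almost everywhere, so `p` is compared with the exact
  -- primitive `p'` of `m`, which agrees with it almost everywhere.
  set p' : ℝ → ℝ := conv (fun _ => 1) m with hp'
  have loc : ∀ {f : ℝ → ℝ} (t : ℝ), IntegrableOn f (Ioi 0) → IntegrableOn f (Ioc 0 t) :=
    fun _ hf => hf.mono_set Ioc_subset_Ioi_self
  have hone : ∀ t, BddIntegrable t fun _ => (1 : ℝ) := fun t => BddIntegrable.const t 1
  have hpp' : ∀ᵐ t ∂(volume.restrict (Ioi 0)), p t = p' t := by
    have h1 := transferKernel_resolvent ha hae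
    rw [ae_restrict_iff' measurableSet_Ioi] at h1 ⊢
    filter_upwards [h1] with t h2 ht
    have ht0 : 0 ≤ t := (mem_Ioi.1 ht).le
    have hk : ∀ s, 0 ≤ s → heatKernel s 1 = conv (fun _ => 1) kernelDeriv s := fun s hs => by
      rw [conv_one, integral_kernelDeriv hs]
    have h3 : conv (fun s => heatKernel s 1) p t = conv (fun _ => 1) (conv kernelDeriv p) t := by
      rw [conv_congr_on ht0 (fun s hs => hk s hs.1.le) (fun _ _ => rfl),
        (hone t).conv_assoc ht0 (loc t integrableOn_kernelDeriv) (loc t hpi)]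
    have h4 := h2 ht
    rw [h3, hk t ht0] at h4
    rw [hp', hm, conv_add_mul_right ht0 (hone t) (loc t integrableOn_kernelDeriv) (loc t hκp)]
    linarith
  have hp'i : IntegrableOn p' (Ioi 0) := hpi.congr_fun_ae hpp'
  have hDp := integrableOn_Ioi_conv hDi hpi
  have hmΨ := integrableOn_Ioi_conv hmi hl
  set c := uPlus u 0 with hc
  set W : ℝ → ℝ := fun t => D t + (-(2 * a)) * (c * p t + conv D p t) +
    2 * (conv m Ψ t + l * p' t) with hW
  have hW1 : IntegrableOn (fun t => c * p t + conv D p t) (Ioi 0) := (hpi.const_mul c).add hDp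
  have hW2 : IntegrableOn (fun t => conv m Ψ t + l * p' t) (Ioi 0) := hmΨ.add (hp'i.const_mul l)
  have hWi : IntegrableOn W (Ioi 0) := (hDi.add (hW1.const_mul _)).add (hW2.const_mul 2)
  refine hasL1Deriv_of_eq_primitive hWi fun t ht => ?_
  rcases ht.eq_or_lt with rfl | ht'
  · simp
  set H : ℝ → ℝ := fun s => heatSemigroup s (u 0) 1 + heatSemigroup s (u 0) (-1) with hH
  have hHeq : ∀ s, 0 < s → H s = conv (fun _ => 1) D s + c * 1 := by
    intro s hs
    rw [conv_one, hH]
    simp only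
    rw [h0.free_eq hc0 hs, hc, uPlus]
    ring
  have e1 : conv p H t = conv (fun _ => 1) (conv D p) t + c * conv (fun _ => 1) p t := by
    rw [conv_comm, conv_congr_on ht (fun s hs => hHeq s hs.1) (fun _ _ => rfl),
      conv_add_mul_left ht ((hone t).conv (loc t hDi)) (hone t) (loc t hpi),
      (hone t).conv_assoc ht (loc t hDi) (loc t hpi)]
  have e2 : conv p Φ t = conv (fun _ => 1) (conv m Ψ) t + l * conv (fun _ => 1) p' t := by
    have h1 : conv p Φ t = conv p' (fun s => Ψ s + l * 1) t := by
      refine conv_congr ht (ae_restrict_of_ae_restrict_of_subset Ioo_subset_Ioi_self hpp')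
        (ae_of_all _ fun s => ?_)
      simp only [hΨ]; ring
    rw [h1, conv_add_mul_right ht ((hone t).conv (loc t hmi)) (loc t hl) (hone t).1,
      conv_comm p' (fun _ => 1), (hone t).conv_assoc ht (loc t hmi) (loc t hl)]
  have hii : ∀ {f : ℝ → ℝ}, IntegrableOn f (Ioi 0) → IntervalIntegrable f volume 0 t := by
    intro f hf
    rw [intervalIntegrable_iff_integrableOn_Ioc_of_le ht]
    exact loc t hf
  have e3 : ∫ s in (0 : ℝ)..t, W s = (∫ s in (0 : ℝ)..t, D s) + -(2 * a) *
      (c * (∫ s in (0 : ℝ)..t, p s) + ∫ s in (0 : ℝ)..t, conv D p s) +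
      2 * ((∫ s in (0 : ℝ)..t, conv m Ψ s) + l * ∫ s in (0 : ℝ)..t, p' s) := by
    rw [hW, intervalIntegral.integral_add ((hii hDi).add ((hii hW1).const_mul _))
      ((hii hW2).const_mul 2), intervalIntegral.integral_add (hii hDi) ((hii hW1).const_mul _),
      intervalIntegral.integral_const_mul, intervalIntegral.integral_const_mul,
      intervalIntegral.integral_add ((hii hpi).const_mul c) (hii hDp),
      intervalIntegral.integral_add (hii hmΨ) ((hii hp'i).const_mul l),
      intervalIntegral.integral_const_mul, intervalIntegral.integral_const_mul]
  have e4 := uPlus_eq_conv_transferKernel ha hae hΦ hu ht'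
  have e5 := hHeq t ht'
  rw [conv_one] at e5
  simp only [conv_one] at e1 e2
  rw [e4, e3]
  change H t - 2 * a * conv p H t + 2 * conv p Φ t = _
  rw [e5, e1, e2]
  ring

end Main

end PointSource

end

theorem proposition5p3 (a : ℝ) (ha_pos : 0 < a) (ha_le : a ≤ Real.exp (-1))
    (u₀ : ℝ → ℝ) (hu₀ : PointSource.MemH1 u₀)
    (Φ : ℝ → ℝ) (hΦ : PointSource.MemLpLocHalfLine Φ ∞)
    (Φinf : ℝ) (hΦinf : 0 ≤ Φinf)
    (hlim : ∃ Φ' : ℝ → ℝ, Φ' =ᵐ[volume.restrict (Ici 0)] Φ ∧ Tendsto Φ' atTop (𝓝 Φinf))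
    (u : ℝ → ℝ → ℝ) (hu : PointSource.IsMildSolution a Φ u₀ u) :
    ((∃ p : ℝ → ℝ, PointSource.IsInverseLaplace p (fun s => PointSource.P a s 1)) ∧
      ∀ p : ℝ → ℝ, PointSource.IsInverseLaplace p (fun s => PointSource.P a s 1) →
        IntegrableOn p (Ioi 0) volume ∧
        Tendsto (PointSource.uPlus u) atTop (𝓝 (2 * Φinf * ∫ t in Ioi (0 : ℝ), p t))) ∧
    (IntegrableOn (fun t => Φ t - Φinf) (Ioi 0) volume →
      PointSource.HasL1Deriv (PointSource.uPlus u)) := by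
  obtain ⟨Φ', hΦ', hΦ'lim⟩ := hlim
  have hp₀ := PointSource.isInverseLaplace_transferKernel ha_pos ha_le
  refine ⟨⟨⟨_, hp₀⟩, fun p hp => ?_⟩, fun h => PointSource.hasL1Deriv_uPlus ha_pos ha_le hΦ h hu⟩
  -- The transform determines `p` up to a null set, which affects neither integrability nor the
  -- integral.
  have hae := hp.ae_eq hp₀
  refine ⟨(PointSource.integrableOn_transferKernel ha_pos ha_le).congr_fun_ae hae.symm, ?_⟩
  rw [integral_congr_ae hae]
  exact PointSource.tendsto_uPlus ha_pos ha_le hΦ hΦ' hΦ'lim hu
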